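/- **Theorem (Basis Theorem).** Let $K$ be a field of characteristic different from $2$, let $q\in K\setminus\{0\}$ with $q^2\neq1$, and let $n\ge1$. For $\mu\in K\setminus\{0\}$ put $I_\mu:=\{\mu^{\epsilon}q^{2m}\mid \epsilon\in\{-1,1\},\ m\in\mathbb Z\}$. Let $\boldsymbol\lambda=(\lambda_1,\dots,\lambda_l)$ be a tuple of elements of $K\setminus\{0\}$ with $I_{\lambda_a}\cap I_{\lambda_b}=\emptyset$ for $a\ne b$, and put $S_{\boldsymbol\lambda}:=I_{\lambda_1}\cup\dots\cup I_{\lambda_l}$. For $i,j\in S_{\boldsymbol\lambda}$ write - $i\nleftrightarrow j$ if $i\ne j$ and $j\notin\{q^2i,q^{-2}i\}$; - $i\to j$ if $j=q^2i\ne q^{-2}i$; - $i\leftarrow j$ if $j=q^{-2}i\neq q^2i$; - $i\leftrightarrow j$ if $j=q^2i=q^{-2}i$. Let $W(B_n)$ be the Weyl group generated by the reflections of $\mathbb Z^n$ in the roots $\pm2\varepsilon_i$ and $\pm\varepsilon_i\pm\varepsilon_j$ ($i\ne j$), with simple reflections $r_0,\dots,r_{n-1}$ attached to the simple roots $\alpha_0=2\varepsilon_1$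 and $\alpha_k=\varepsilon_{k+1}-\varepsilon_k$ ($1\le k\le n-1$). It acts on $(S_{\boldsymbol\lambda})^n$ by $$r_0\cdot(i_1,\dots,i_n)=(i_1^{-1},i_2,\dots,i_n),\qquad r_k\cdot(\dots,i_k,i_{k+1},\dots)=(\dots,i_{k+1},i_k,\dots).$$ Let $\beta$ be a finite subset of $(S_{\boldsymbol\lambda})^n$ stable under this action, that is, a finite union of $W(B_n)$-orbits. Let $V^\beta_{\boldsymbol\lambda}$ be the unital $K$-algebra generated by $\psi_a$ ($0\le a\le n-1$), $y_j$ ($1\le j\le n$) and $e(\mathbf i)$ ($\mathbf i\in\beta$), with the following defining relations, for all indices $a,b\in\{0,\dots,n-1\}$ with $b\neq0$, all $j,k\in\{1,\dots,n\}$ and all $\mathbf i,\mathbf j\in\beta$ for which they make sense, where $\pi_b$ is the transposition of $b$ and $b+1$: $$\sum_{\mathbf i\in\beta}e(\mathbf i)=1,\quad e(\mathbf i)e(\mathbf j)=\delta_{\mathbf i,\mathbf j}e(\mathbf i),\quad y_jy_k=y_ky_j,\quad y_je(\mathbf i)=e(\mathbf i)y_j,\quad \psi_ae(\mathbf i)=e(r_a\cdot\mathbf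 i)\psi_a,$$ $$(\psi_by_j-y_{\pi_b(j)}\psi_b)e(\mathbf i)=\begin{cases}-e(\mathbf i)&j=b,\ i_b=i_{b+1},\\ e(\mathbf i)&j=b+1,\ i_b=i_{b+1},\\ 0&\text{else,}\end{cases}\qquad \psi_a\psi_b=\psi_b\psi_a\ \text{ if }|a-b|>1,$$ $$\psi_b^2e(\mathbf i)=\begin{cases}0&i_b=i_{b+1},\\ e(\mathbf i)&i_b\nleftrightarrow i_{b+1},\\ (y_{b+1}-y_b)e(\mathbf i)&i_b\to i_{b+1},\\ (y_b-y_{b+1})e(\mathbf i)&i_b\leftarrow i_{b+1},\\ (y_{b+1}-y_b)(y_b-y_{b+1})e(\mathbf i)&i_b\leftrightarrow i_{b+1},\end{cases}$$ $$(\psi_b\psi_{b+1}\psi_b-\psi_{b+1}\psi_b\psi_{b+1})e(\mathbf i)=\begin{cases}e(\mathbf i)&i_b=i_{b+2}\to i_{b+1},\\ -e(\mathbf i)&i_b=i_{b+2}\leftarrow i_{b+1},\\ (y_{b+2}-2y_{b+1}+y_b)e(\mathbf i)&i_b=i_{b+2}\leftrightarrow i_{b+1},\\ 0&\text{else,}\end{cases}$$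 $$\psi_0y_1+y_1\psi_0=0,\quad \psi_0y_j=y_j\psi_0\ (j>1),\quad \psi_0^2=1,\quad (\psi_0\psi_1)^2=(\psi_1\psi_0)^2.$$ (This algebra belongs to the case $p^2=1$ of the two parameters $p,q$ of the affine Hecke algebra of type $B$; $p$ does not occur in its definition.) For each $w\in W(B_n)$ fix a reduced expression $w=r_{a_1}\cdots r_{a_k}$ in $r_0,\dots,r_{n-1}$ and put $\psi_w:=\psi_{a_1}\cdots\psi_{a_k}$. Then, for every such choice of reduced expressions, the elements $$y_1^{m_1}\cdots y_n^{m_n}\,\psi_w\,e(\mathbf i),\qquad w\in W(B_n),\ (m_1,\dots,m_n)\in(\mathbb Z_{\ge0})^n,\ \mathbf i\in\beta,$$ form a $K$-basis of $V^\beta_{\boldsymbol\lambda}$ (indexed by the triples $(w,\mathbf m,\mathbf i)$). -/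

import Mathlib

namespace QuiverHeckeB

/-! Throughout, a position `k ∈ {1, …, n}` of the mathematics is the element of `Fin n` with value
`k - 1`, while a label `a ∈ {0, …, n - 1}` of a simple reflection is the element of `Fin n` with
value `a`. For a label `b ≠ 0`, the positions `b` and `b + 1` of the mathematics are therefore
`prev b` and `b` in `Fin n`. -/

section WeylGroup

/-- The lattice `L = ⨁ ℤ ε_i`, with its standard scalar product `α ⬝ᵥ x`. -/
abbrev Lattice (n : ℕ) : Type := Fin n → ℤ

/-- The element with value `b - 1` (for `b = 0`, which is never used, it is `b` itself). -/
def prev {n : ℕ} (b : Fin n) : Fin n := ⟨b.val - 1, by omega⟩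

/-- The root system `R = {± 2 ε_i} ∪ {± ε_i ± ε_j | i ≠ j}`. -/
def rootsB (n : ℕ) : Set (Lattice n) :=
  {α | (∃ (i : Fin n) (c : ℤ), (c = 1 ∨ c = -1) ∧ α = Pi.single i (2 * c)) ∨
    ∃ (i j : Fin n) (c d : ℤ), i ≠ j ∧ (c = 1 ∨ c = -1) ∧ (d = 1 ∨ d = -1) ∧
      α = Pi.single i c + Pi.single j d}

/-- `g` is the reflection `x ↦ x - 2 (α, x) / (α, α) α`; written without division. -/
def IsReflection {n : ℕ} (α : Lattice n) (g : Lattice n ≃ₗ[ℤ] Lattice n) : Prop :=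
  ∀ x : Lattice n, (α ⬝ᵥ α) • g x = (α ⬝ᵥ α) • x - (2 * (α ⬝ᵥ x)) • α

/-- The Weyl group `W(B_n)`: the group generated by the reflections `r_α`, `α ∈ R`. -/
def weylGroupB (n : ℕ) : Subgroup (Lattice n ≃ₗ[ℤ] Lattice n) :=
  Subgroup.closure {g | ∃ α ∈ rootsB n, IsReflection α g}

/-- The simple roots `α_0 = 2 ε_1` and `α_i = ε_{i+1} - ε_i`. -/
def simpleRoot {n : ℕ} (a : Fin n) : Lattice n :=
  if a.val = 0 then Pi.single a 2 else Pi.single a 1 - Pi.single (prev a) 1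

/-- The simple reflections: `r_0` changes the sign of the first coordinate, and `r_b` exchanges
the coordinates in the positions `b` and `b + 1`. -/
def simpleReflection {n : ℕ} (a : Fin n) : Lattice n ≃ₗ[ℤ] Lattice n :=
  if a.val = 0 then
    LinearEquiv.piCongrRight fun j => if j = a then LinearEquiv.neg ℤ else LinearEquiv.refl ℤ ℤ
  else LinearEquiv.funCongrLeft ℤ ℤ (Equiv.swap (prev a) a)

theorem prev_ne {n : ℕ} {a : Fin n} (h : a.val ≠ 0) : prev a ≠ a := by
  intro h'
  have := congrArg Fin.val h'
  simp only [prev] at this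
  omega

theorem simpleRoot_mem {n : ℕ} (a : Fin n) : simpleRoot a ∈ rootsB n := by
  unfold simpleRoot
  split_ifs with h
  · exact Or.inl ⟨a, 1, Or.inl rfl, by simp⟩
  · exact Or.inr ⟨a, prev a, 1, -1, (prev_ne h).symm, Or.inl rfl, Or.inr rfl, by
      simp [sub_eq_add_neg, Pi.single_neg]⟩

/-- `simpleReflection a` is the reflection in the simple root `α_a`. -/
theorem isReflection_simple {n : ℕ} (a : Fin n) :
    IsReflection (simpleRoot a) (simpleReflection a) := by
  intro x
  unfold simpleRoot simpleReflection
  split_ifs with h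
  · ext j
    by_cases hj : j = a
    · subst hj
      simp
      ring
    · simp [hj]
  · have hp := prev_ne h
    ext j
    by_cases hj : j = a
    · subst hj
      simp [hp, hp.symm, sub_dotProduct, LinearMap.funLeft_apply]
      ring
    · by_cases hj' : j = prev a
      · subst hj'
        simp [hp, hp.symm, sub_dotProduct, LinearMap.funLeft_apply]
        ring
      · simp [hp, hp.symm, sub_dotProduct, LinearMap.funLeft_apply, hj, hj',
          Equiv.swap_apply_of_ne_of_ne hj' hj]

theorem simpleReflection_mem {n : ℕ} (a : Fin n) : simpleReflection a ∈ weylGroupB n :=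
  Subgroup.subset_closure ⟨_, simpleRoot_mem a, isReflection_simple a⟩

/-- `ω` is a reduced expression of `w` in the generators `r_0, …, r_{n-1}`: its product is `w`,
and no shorter word has product `w`. -/
def IsReducedExpression {n : ℕ} (ω : List (Fin n)) (w : weylGroupB n) : Prop :=
  (ω.map simpleReflection).prod = (w : Lattice n ≃ₗ[ℤ] Lattice n) ∧
    ∀ ω' : List (Fin n),
      (ω'.map simpleReflection).prod = (w : Lattice n ≃ₗ[ℤ] Lattice n) → ω.length ≤ ω'.length

end WeylGroup

section Quiver

/-- `I_μ = {μ^ε q^{2m} | ε ∈ {-1, 1}, m ∈ ℤ}`. -/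
def vertexClass {K : Type*} [Field K] (q μ : Kˣ) : Set Kˣ :=
  {x | ∃ ε m : ℤ, (ε = 1 ∨ ε = -1) ∧ x = μ ^ ε * q ^ (2 * m)}

/-- `S_𝛌 = I_{λ_1} ∪ … ∪ I_{λ_l}`, the vertex set of the quiver. -/
def vertexSet {K : Type*} [Field K] {l : ℕ} (q : Kˣ) (lam : Fin l → Kˣ) : Set Kˣ :=
  ⋃ a, vertexClass q (lam a)

/-- `i ↮ j` -/
def NoArrow {K : Type*} [Field K] (q i j : Kˣ) : Prop :=
  i ≠ j ∧ j ≠ q ^ (2 : ℤ) * i ∧ j ≠ q ^ (-2 : ℤ) * i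

/-- `i → j` -/
def ArrowTo {K : Type*} [Field K] (q i j : Kˣ) : Prop :=
  j = q ^ (2 : ℤ) * i ∧ j ≠ q ^ (-2 : ℤ) * i

/-- `i ← j` -/
def ArrowFrom {K : Type*} [Field K] (q i j : Kˣ) : Prop :=
  j = q ^ (-2 : ℤ) * i ∧ j ≠ q ^ (2 : ℤ) * i

/-- `i ↔ j` -/
def ArrowBoth {K : Type*} [Field K] (q i j : Kˣ) : Prop :=
  j = q ^ (2 : ℤ) * i ∧ j = q ^ (-2 : ℤ) * i

/-- The action of the simple reflection `r_a` on `n`-tuples: `r_0` inverts the first entry, and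
`r_b` exchanges the entries in the positions `b` and `b + 1`. -/
def tupleAct {K : Type*} [Field K] {n : ℕ} (a : Fin n) (i : Fin n → Kˣ) : Fin n → Kˣ :=
  if a.val = 0 then Function.update i a (i a)⁻¹ else i ∘ Equiv.swap (prev a) a

/-- A finite subset of `(S_𝛌)^n` that is stable under the action of `W(B_n)`, that is, under that
of its generators `r_0, …, r_{n-1}`; equivalently, a finite union of orbits. -/
structure StableFinset {K : Type*} [Field K] {l : ℕ} (q : Kˣ) (lam : Fin l → Kˣ) (n : ℕ) where
  carrier : Finset (Fin n → Kˣ)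
  mem_vertexSet : ∀ i ∈ carrier, ∀ k, i k ∈ vertexSet q lam
  stable : ∀ i ∈ carrier, ∀ a, tupleAct a i ∈ carrier

end Quiver

section Algebra

variable {K : Type*} [Field K] {l : ℕ} {q : Kˣ} {lam : Fin l → Kˣ} {n : ℕ}

/-- The index set `β`, as a type. -/
abbrev StableFinset.Idx (β : StableFinset q lam n) : Type _ := {i : Fin n → Kˣ // i ∈ β.carrier}

/-- `r_a · i` for `i ∈ β`. -/
def StableFinset.act (β : StableFinset q lam n) (a : Fin n) (i : β.Idx) : β.Idx :=
  ⟨tupleAct a i.1, β.stable i.1 i.2 a⟩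

/-- The generators `ψ_a` (`0 ≤ a ≤ n - 1`), `y_j` (`1 ≤ j ≤ n`) and `e(i)` (`i ∈ β`). -/
inductive Gen (β : StableFinset q lam n) : Type _
  | psi (a : Fin n) : Gen β
  | y (j : Fin n) : Gen β
  | e (i : β.Idx) : Gen β

namespace Free

/-- `ψ_a` in the free algebra. -/
abbrev ψ (β : StableFinset q lam n) (a : Fin n) : FreeAlgebra K (Gen β) :=
  FreeAlgebra.ι K (Gen.psi a)

/-- `y_j` in the free algebra. -/
abbrev y (β : StableFinset q lam n) (j : Fin n) : FreeAlgebra K (Gen β) :=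
  FreeAlgebra.ι K (Gen.y j)

/-- `e(i)` in the free algebra. -/
abbrev e (β : StableFinset q lam n) (i : β.Idx) : FreeAlgebra K (Gen β) :=
  FreeAlgebra.ι K (Gen.e i)

end Free

open Free in
/-- The defining relations. Everywhere `b` and `c` are labels different from `0`. -/
inductive Rel (β : StableFinset q lam n) : FreeAlgebra K (Gen β) → FreeAlgebra K (Gen β) → Prop
  -- idempotents
  | e_sum : Rel β (∑ i : β.Idx, e β i) 1
  | e_idem (i : β.Idx) : Rel β (e β i * e β i) (e β i)
  | e_orth (i j : β.Idx) (h : i ≠ j) : Rel β (e β i * e β j) 0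
  -- polynomial generators
  | y_comm (j k : Fin n) : Rel β (y β j * y β k) (y β k * y β j)
  | y_e (j : Fin n) (i : β.Idx) : Rel β (y β j * e β i) (e β i * y β j)
  -- `ψ_a e(i) = e(r_a i) ψ_a`
  | psi_e (a : Fin n) (i : β.Idx) : Rel β (ψ β a * e β i) (e β (β.act a i) * ψ β a)
  -- `(ψ_b y_j - y_{π_b(j)} ψ_b) e(i)`
  | psi_y_left (b : Fin n) (hb : b.val ≠ 0) (i : β.Idx) (h : i.1 (prev b) = i.1 b) :
      Rel β ((ψ β b * y β (prev b) - y β b * ψ β b) * e β i) (-e β i)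
  | psi_y_right (b : Fin n) (hb : b.val ≠ 0) (i : β.Idx) (h : i.1 (prev b) = i.1 b) :
      Rel β ((ψ β b * y β b - y β (prev b) * ψ β b) * e β i) (e β i)
  | psi_y_else (b : Fin n) (hb : b.val ≠ 0) (j : Fin n) (i : β.Idx)
      (h : ¬ ((j = prev b ∨ j = b) ∧ i.1 (prev b) = i.1 b)) :
      Rel β ((ψ β b * y β j - y β (Equiv.swap (prev b) b j) * ψ β b) * e β i) 0
  -- `ψ_a ψ_b = ψ_b ψ_a` if `|a - b| > 1`
  | psi_comm (a b : Fin n) (hb : b.val ≠ 0) (h : a.val + 1 < b.val ∨ b.val + 1 < a.val) :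
      Rel β (ψ β a * ψ β b) (ψ β b * ψ β a)
  -- `ψ_b² e(i)`
  | psi_sq_eq (b : Fin n) (hb : b.val ≠ 0) (i : β.Idx) (h : i.1 (prev b) = i.1 b) :
      Rel β (ψ β b ^ 2 * e β i) 0
  | psi_sq_none (b : Fin n) (hb : b.val ≠ 0) (i : β.Idx) (h : NoArrow q (i.1 (prev b)) (i.1 b)) :
      Rel β (ψ β b ^ 2 * e β i) (e β i)
  | psi_sq_to (b : Fin n) (hb : b.val ≠ 0) (i : β.Idx) (h : ArrowTo q (i.1 (prev b)) (i.1 b)) :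
      Rel β (ψ β b ^ 2 * e β i) ((y β b - y β (prev b)) * e β i)
  | psi_sq_from (b : Fin n) (hb : b.val ≠ 0) (i : β.Idx)
      (h : ArrowFrom q (i.1 (prev b)) (i.1 b)) :
      Rel β (ψ β b ^ 2 * e β i) ((y β (prev b) - y β b) * e β i)
  | psi_sq_both (b : Fin n) (hb : b.val ≠ 0) (i : β.Idx)
      (h : ArrowBoth q (i.1 (prev b)) (i.1 b)) :
      Rel β (ψ β b ^ 2 * e β i) ((y β b - y β (prev b)) * (y β (prev b) - y β b) * e β i)
  -- `(ψ_b ψ_{b+1} ψ_b - ψ_{b+1} ψ_b ψ_{b+1}) e(i)`, with `c = b + 1`; the positions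
  -- `b`, `b + 1`, `b + 2` of the mathematics are `prev b`, `b`, `c`
  | braid_to (b c : Fin n) (hb : b.val ≠ 0) (hc : c.val = b.val + 1) (i : β.Idx)
      (h : i.1 (prev b) = i.1 c) (h' : ArrowTo q (i.1 c) (i.1 b)) :
      Rel β ((ψ β b * ψ β c * ψ β b - ψ β c * ψ β b * ψ β c) * e β i) (e β i)
  | braid_from (b c : Fin n) (hb : b.val ≠ 0) (hc : c.val = b.val + 1) (i : β.Idx)
      (h : i.1 (prev b) = i.1 c) (h' : ArrowFrom q (i.1 c) (i.1 b)) :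
      Rel β ((ψ β b * ψ β c * ψ β b - ψ β c * ψ β b * ψ β c) * e β i) (-e β i)
  | braid_both (b c : Fin n) (hb : b.val ≠ 0) (hc : c.val = b.val + 1) (i : β.Idx)
      (h : i.1 (prev b) = i.1 c) (h' : ArrowBoth q (i.1 c) (i.1 b)) :
      Rel β ((ψ β b * ψ β c * ψ β b - ψ β c * ψ β b * ψ β c) * e β i)
        ((y β c - 2 * y β b + y β (prev b)) * e β i)
  | braid_else (b c : Fin n) (hb : b.val ≠ 0) (hc : c.val = b.val + 1) (i : β.Idx)
      (h : ¬ (i.1 (prev b) = i.1 c ∧ (ArrowTo q (i.1 c) (i.1 b) ∨ ArrowFrom q (i.1 c) (i.1 b) ∨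
        ArrowBoth q (i.1 c) (i.1 b)))) :
      Rel β ((ψ β b * ψ β c * ψ β b - ψ β c * ψ β b * ψ β c) * e β i) 0
  -- `ψ_0 y_1 + y_1 ψ_0 = 0`, `ψ_0 y_j = y_j ψ_0` for `j > 1`, `ψ_0² = 1`
  | psi_zero_y_one (z : Fin n) (hz : z.val = 0) : Rel β (ψ β z * y β z + y β z * ψ β z) 0
  | psi_zero_y (z j : Fin n) (hz : z.val = 0) (hj : j.val ≠ 0) :
      Rel β (ψ β z * y β j) (y β j * ψ β z)
  | psi_zero_sq (z : Fin n) (hz : z.val = 0) : Rel β (ψ β z ^ 2) 1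
  -- `(ψ_0 ψ_1)² - (ψ_1 ψ_0)² = 0`
  | psi_zero_one (z o : Fin n) (hz : z.val = 0) (ho : o.val = 1) :
      Rel β ((ψ β z * ψ β o) ^ 2 - (ψ β o * ψ β z) ^ 2) 0

/-- The algebra `V_𝛌^β`: the unital `K`-algebra given by these generators and relations. -/
abbrev V (β : StableFinset q lam n) : Type _ := RingQuot (Rel β)

/-- The image of a generator in `V_𝛌^β`. -/
def V.gen (β : StableFinset q lam n) (g : Gen β) : V β :=
  RingQuot.mkAlgHom K (Rel β) (FreeAlgebra.ι K g)

/-- `ψ_a ∈ V_𝛌^β`. -/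
def V.psi (β : StableFinset q lam n) (a : Fin n) : V β := V.gen β (Gen.psi a)

/-- `y_j ∈ V_𝛌^β`. -/
def V.y (β : StableFinset q lam n) (j : Fin n) : V β := V.gen β (Gen.y j)

/-- `e(i) ∈ V_𝛌^β`. -/
def V.e (β : StableFinset q lam n) (i : β.Idx) : V β := V.gen β (Gen.e i)

/-- `ψ_{a_1} ⋯ ψ_{a_k}` for a word `a_1 … a_k`. -/
def V.psiWord (β : StableFinset q lam n) (ω : List (Fin n)) : V β := (ω.map (V.psi β)).prod

/-- `y_1^{m_1} ⋯ y_n^{m_n}`. -/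
def V.yMonomial (β : StableFinset q lam n) (m : Fin n → ℕ) : V β :=
  (List.ofFn fun j => V.y β j ^ m j).prod

end Algebra

end QuiverHeckeB

/-! Spanning and linear independence are proved separately.

Spanning. Filter the algebra by the number of factors ψ. Moving ψ_a past y_j costs only terms
without ψ, each ψ_a² has filtration degree zero, and the type A braid relations hold up to terms
without ψ; the remaining braid and commutation relations hold exactly. Modulo terms with fewer ψ's
every product of generators thus becomes a combination of elements p ψ_ω e(i) with p a polynomial in
the y_j (`V.genProd_mem_wordSpan_sup`). For reduced ω the leading part of ψ_ω depends only on the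
product of ω (Matsumoto's argument, `V.psiWord_sub_mem_filtration`), and for other ω it vanishes
(`V.psiWord_mem_filtration_of_not_isReduced`). Induction along the filtration finishes. The
combinatorial input is the exchange condition for W(B_n), derived from the root system with
positivity measured by the linear form `height`.

Independence. The algebra acts on tuples of rational functions indexed by β: y_j multiplies, e(i)
projects, and ψ_a is a reflection, possibly multiplied by a linear form, or a divided difference.
Most of the work is in the braid relations (`psiOp_braid`, `psiOp_zero_one`). In this representation
ψ_w is w with a nonzero coefficient plus products of shorter words, with rational functions as
coefficients (`exists_expansion`). In characteristic other than 2 the Weyl group acts faithfully on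
the rational functions, so by Dedekind its elements are independent over that field. In a linear
relation the terms of greatest length therefore vanish, by the independence of monomials. -/

namespace QuiverHeckeB

/-! ### The Weyl group: roots, descents and the exchange condition. -/

section Words

variable {n : ℕ}

/-- The product in the automorphism group of the lattice of a word in the simple reflections. -/
def wordProd (ω : List (Fin n)) : Lattice n ≃ₗ[ℤ] Lattice n := (ω.map simpleReflection).prod

@[simp] theorem wordProd_nil : wordProd ([] : List (Fin n)) = 1 := rfl

@[simp] theorem wordProd_cons (a : Fin n) (ω : List (Fin n)) :
    wordProd (a :: ω) = simpleReflection a * wordProd ω := by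
  simp [wordProd]

theorem wordProd_append (ω ω' : List (Fin n)) :
    wordProd (ω ++ ω') = wordProd ω * wordProd ω' := by
  simp [wordProd]

theorem wordProd_mem (ω : List (Fin n)) : wordProd ω ∈ weylGroupB n :=
  Subgroup.list_prod_mem _ (by simpa using fun a _ => simpleReflection_mem a)

theorem simpleReflection_apply (a : Fin n) (x : Lattice n) (k : Fin n) :
    simpleReflection a x k =
      if a.val = 0 then (if k = a then -x k else x k) else x (Equiv.swap (prev a) a k) := by
  unfold simpleReflection
  by_cases h : a.val = 0
  · by_cases h' : k = a <;> simp [h, h']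
  · simp [h, LinearMap.funLeft_apply]

theorem simpleReflection_mul_self (a : Fin n) :
    simpleReflection a * simpleReflection a = 1 := by
  ext x k
  simp only [LinearEquiv.mul_apply, simpleReflection_apply, LinearEquiv.coe_one, id]
  split_ifs <;> simp

theorem simpleReflection_mul_cancel_left (a : Fin n) (g : Lattice n ≃ₗ[ℤ] Lattice n) :
    simpleReflection a * (simpleReflection a * g) = g := by
  rw [← mul_assoc, simpleReflection_mul_self, one_mul]

theorem simpleReflection_inv (a : Fin n) : (simpleReflection a)⁻¹ = simpleReflection a :=
  inv_eq_of_mul_eq_one_left (simpleReflection_mul_self a)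

theorem simpleReflection_dotProduct (a : Fin n) (x z : Lattice n) :
    simpleReflection a x ⬝ᵥ simpleReflection a z = x ⬝ᵥ z := by
  simp only [dotProduct, simpleReflection_apply]
  split_ifs with h
  · refine Finset.sum_congr rfl fun k _ => ?_
    split_ifs <;> ring
  · exact Equiv.sum_comp (Equiv.swap (prev a) a) fun k => x k * z k

theorem wordProd_dotProduct (ω : List (Fin n)) (x z : Lattice n) :
    wordProd ω x ⬝ᵥ wordProd ω z = x ⬝ᵥ z := by
  induction ω with
  | nil => rfl
  | cons a ω ih => simp [LinearEquiv.mul_apply, simpleReflection_dotProduct, ih]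

theorem simpleRoot_dotProduct_self_ne (a : Fin n) :
    simpleRoot a ⬝ᵥ simpleRoot a ≠ 0 := by
  rw [Ne, dotProduct_self_eq_zero]
  intro h
  have := congrFun h a
  unfold simpleRoot at this
  split_ifs at this with h0
  · simp at this
  · simp [(prev_ne h0).symm] at this

theorem simpleReflection_simpleRoot (a : Fin n) :
    simpleReflection a (simpleRoot a) = -simpleRoot a := by
  have h := isReflection_simple a (simpleRoot a)
  have h0 := simpleRoot_dotProduct_self_ne a
  refine smul_right_injective _ h0 ?_
  simp only [h]
  module

/-- Conjugating the reflection in a simple root by a product of simple reflections that takes it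
to a simple root. -/
theorem wordProd_mul_simpleReflection (ω : List (Fin n)) (a b : Fin n)
    (h : wordProd ω (simpleRoot b) = simpleRoot a) :
    wordProd ω * simpleReflection b = simpleReflection a * wordProd ω := by
  ext1 x
  have hb := congrArg (wordProd ω) (isReflection_simple b x)
  have ha := isReflection_simple a (wordProd ω x)
  have hN : simpleRoot a ⬝ᵥ simpleRoot a = simpleRoot b ⬝ᵥ simpleRoot b := by
    rw [← h, wordProd_dotProduct]
  have hx : simpleRoot a ⬝ᵥ wordProd ω x = simpleRoot b ⬝ᵥ x := by
    rw [← h, wordProd_dotProduct]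
  refine smul_right_injective _ (simpleRoot_dotProduct_self_ne b) ?_
  simp only [LinearEquiv.mul_apply]
  rw [hN, hx] at ha
  rw [ha, ← map_smul, hb, map_sub, map_smul, map_smul, h]

/-- A linear form that is positive on the simple roots and does not vanish on the roots. -/
def height (x : Lattice n) : ℤ := (fun k : Fin n => (k.val : ℤ) + 1) ⬝ᵥ x

theorem height_add (x z : Lattice n) : height (x + z) = height x + height z := dotProduct_add _ _ _

theorem height_neg (x : Lattice n) : height (-x) = -height x := dotProduct_neg _ _

theorem height_smul (c : ℤ) (x : Lattice n) : height (c • x) = c * height x := by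
  exact dotProduct_smul _ _ _

theorem height_single (k : Fin n) (c : ℤ) : height (Pi.single k c) = (k.val + 1) * c := by
  simp [height]

theorem simpleReflection_single (a k : Fin n) (c : ℤ) :
    simpleReflection a (Pi.single k c) =
      if a.val = 0 then (if k = a then Pi.single k (-c) else Pi.single k c)
      else Pi.single (Equiv.swap (prev a) a k) c := by
  ext j
  rw [simpleReflection_apply]
  split_ifs with h h1 h2 h3
  · simp [h1, h2]
  · subst h1; simp [Ne.symm h2]
  · subst h3; simp [h1]
  · rfl
  · simp only [Pi.single_apply, ← Equiv.eq_symm_apply, Equiv.symm_swap]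

theorem simpleReflection_mem_rootsB (a : Fin n) {α : Lattice n} (hα : α ∈ rootsB n) :
    simpleReflection a α ∈ rootsB n := by
  rcases hα with ⟨i, c, hc, rfl⟩ | ⟨i, j, c, d, hij, hc, hd, rfl⟩
  · left
    rw [simpleReflection_single]
    split_ifs
    · exact ⟨i, -c, by omega, by simp⟩
    · exact ⟨i, c, hc, rfl⟩
    · exact ⟨_, c, hc, rfl⟩
  · right
    rw [map_add, simpleReflection_single, simpleReflection_single]
    split_ifs
    · exact ⟨i, j, -c, -d, hij, by omega, by omega, rfl⟩
    · exact ⟨i, j, -c, d, hij, by omega, by omega, rfl⟩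
    · exact ⟨i, j, c, -d, hij, by omega, by omega, rfl⟩
    · exact ⟨i, j, c, d, hij, by omega, by omega, rfl⟩
    · exact ⟨_, _, c, d, by simpa using hij, hc, hd, rfl⟩

theorem wordProd_inv_mem_rootsB (ω : List (Fin n)) {α : Lattice n} (hα : α ∈ rootsB n) :
    (wordProd ω)⁻¹ α ∈ rootsB n := by
  induction ω generalizing α with
  | nil => simpa using hα
  | cons a ω ih =>
    rw [wordProd_cons, mul_inv_rev, simpleReflection_inv, LinearEquiv.mul_apply]
    exact ih (simpleReflection_mem_rootsB a hα)

theorem height_ne_zero {α : Lattice n} (hα : α ∈ rootsB n) : height α ≠ 0 := by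
  rcases hα with ⟨i, c, hc, rfl⟩ | ⟨i, j, c, d, hij, hc, hd, rfl⟩
  · rw [height_single]
    rcases hc with rfl | rfl <;> omega
  · rw [height_add, height_single, height_single]
    have := Fin.val_ne_of_ne hij
    rcases hc with rfl | rfl <;> rcases hd with rfl | rfl <;> omega

theorem height_simpleRoot_pos (a : Fin n) : 0 < height (simpleRoot a) := by
  unfold simpleRoot
  split_ifs with h
  · rw [height_single]; omega
  · rw [sub_eq_add_neg, height_add, height_neg, height_single, height_single]
    simp only [prev]
    omega

theorem swap_prev_val (a k : Fin n) :
    (Equiv.swap (prev a) a k).val =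
      if k.val = a.val - 1 then a.val else if k.val = a.val then a.val - 1 else k.val := by
  rw [Equiv.swap_apply_def]
  simp only [Fin.ext_iff, prev]
  split_ifs <;> simp_all

/-- A simple reflection makes only one positive root negative. -/
theorem eq_simpleRoot_of_height {a : Fin n} {α : Lattice n} (hα : α ∈ rootsB n)
    (h : 0 < height α) (h' : height (simpleReflection a α) < 0) : α = simpleRoot a := by
  unfold simpleRoot
  rcases hα with ⟨i, c, hc, rfl⟩ | ⟨i, j, c, d, hij, hc, hd, rfl⟩
  · rw [simpleReflection_single] at h'
    rw [height_single] at h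
    split_ifs at h' ⊢ with h0 h1
    · have : c = 1 := by rcases hc with rfl | rfl <;> omega
      simp [h1, this]
    · rw [height_single] at h'; omega
    · rw [height_single] at h'
      rcases hc with rfl | rfl <;> omega
  · have hij' := Fin.val_ne_of_ne hij
    rw [map_add, simpleReflection_single, simpleReflection_single] at h'
    rw [height_add, height_single, height_single] at h
    by_cases h0 : a.val = 0
    -- `r_0` changes the sign of ε_1 only, whose weight 1 is the least, and this cannot decide the
    -- sign of the height of ±ε_i ± ε_j.
    · exfalso
      simp only [h0, if_true, Fin.ext_iff] at h'
      split_ifs at h' <;> rw [height_add, height_single, height_single] at h' <;>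
        rcases hc with rfl | rfl <;> rcases hd with rfl | rfl <;> omega
    · simp only [h0, if_false] at h' ⊢
      rw [height_add, height_single, height_single, swap_prev_val, swap_prev_val] at h'
      -- Exchanging two neighbouring weights reverses the order of that pair only, so the root is
      -- ε_{a+1} - ε_a; the two cases account for the order in which its summands are listed.
      have key : (c = 1 ∧ d = -1 ∧ i.val = a.val ∧ j.val = a.val - 1) ∨
          (c = -1 ∧ d = 1 ∧ j.val = a.val ∧ i.val = a.val - 1) := by
        rcases hc with rfl | rfl <;> rcases hd with rfl | rfl <;> split_ifs at h' <;> omega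
      rcases key with ⟨rfl, rfl, hi, hj⟩ | ⟨rfl, rfl, hj, hi⟩
      · have hi : i = a := Fin.ext hi
        have hj : j = prev a := Fin.ext hj
        rw [hi, hj, Pi.single_neg]; abel
      · have hj : j = a := Fin.ext hj
        have hi : i = prev a := Fin.ext hi
        rw [hi, hj, Pi.single_neg]; abel

/-- `a` is a left descent of `g`. -/
def IsDescent (a : Fin n) (g : Lattice n ≃ₗ[ℤ] Lattice n) : Prop := height (g⁻¹ (simpleRoot a)) < 0

/-- The roots g⁻¹(α_a) and (r_a g)⁻¹(α_a) are opposite, and no root has height zero. -/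
theorem isDescent_simpleReflection_mul (a : Fin n) (ω : List (Fin n))
    (h : ¬ IsDescent a (wordProd ω)) : IsDescent a (simpleReflection a * wordProd ω) := by
  unfold IsDescent at *
  rw [mul_inv_rev, simpleReflection_inv, LinearEquiv.mul_apply, simpleReflection_simpleRoot,
    map_neg, height_neg]
  have := height_ne_zero (wordProd_inv_mem_rootsB ω (simpleRoot_mem a))
  omega

/-- The exchange condition, with a positive root in place of a simple one. -/
theorem exists_delete {a : Fin n} (τ ω : List (Fin n))
    (hτ : 0 < height ((wordProd τ)⁻¹ (simpleRoot a)))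
    (h : height ((wordProd (τ ++ ω))⁻¹ (simpleRoot a)) < 0) :
    ∃ u : List (Fin n), u.length + 1 = ω.length ∧
      wordProd (τ ++ u) = simpleReflection a * wordProd (τ ++ ω) := by
  induction ω generalizing τ with
  | nil => rw [List.append_nil] at h; omega
  | cons b ω ih =>
    have hb : (wordProd (τ ++ [b]))⁻¹ (simpleRoot a) =
        simpleReflection b ((wordProd τ)⁻¹ (simpleRoot a)) := by
      rw [wordProd_append, mul_inv_rev, LinearEquiv.mul_apply]
      simp [simpleReflection_inv]
    have hne := height_ne_zero (wordProd_inv_mem_rootsB (τ ++ [b]) (simpleRoot_mem a))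
    -- The prefix `τ` is extended as long as τ⁻¹(α_a) stays positive. At the letter `b` where the
    -- sign changes, this root must be α_b, so τ r_b = r_a τ and `b` can be traded for r_a on the
    -- left.
    by_cases hpos : 0 < height ((wordProd (τ ++ [b]))⁻¹ (simpleRoot a))
    · obtain ⟨u, hu, hu'⟩ := ih (τ ++ [b]) hpos (by simpa using h)
      exact ⟨b :: u, by simp [hu], by simpa using hu'⟩
    · refine ⟨ω, rfl, ?_⟩
      have hroot := eq_simpleRoot_of_height (a := b)
        (wordProd_inv_mem_rootsB τ (simpleRoot_mem a)) hτ (by rw [← hb]; omega)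
      have hroot' : wordProd τ (simpleRoot b) = simpleRoot a := by
        rw [← hroot, ← LinearEquiv.mul_apply, mul_inv_cancel]; rfl
      have hc := wordProd_mul_simpleReflection τ a b hroot'
      rw [wordProd_append, wordProd_append, wordProd_cons, ← mul_assoc, ← mul_assoc, mul_assoc _ _
        (simpleReflection b), hc, simpleReflection_mul_cancel_left]

/-- The exchange condition. -/
theorem IsDescent.exists_word {a : Fin n} {g : Lattice n ≃ₗ[ℤ] Lattice n} (h : IsDescent a g)
    {ω : List (Fin n)} (hω : wordProd ω = g) :
    ∃ u : List (Fin n), u.length + 1 = ω.length ∧ wordProd u = simpleReflection a * g := by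
  subst hω
  obtain ⟨u, hu, hu'⟩ := exists_delete [] ω (by simpa using height_simpleRoot_pos a) h
  exact ⟨u, hu, hu'⟩

/-- No shorter word has the same product. -/
def IsReduced (ω : List (Fin n)) : Prop :=
  ∀ ω' : List (Fin n), wordProd ω' = wordProd ω → ω.length ≤ ω'.length

theorem IsReduced.tail {a : Fin n} {ω : List (Fin n)} (h : IsReduced (a :: ω)) : IsReduced ω := by
  intro ω' hω'
  have := h (a :: ω') (by simp [hω'])
  simpa using this

theorem IsReduced.isDescent {a : Fin n} {ω : List (Fin n)} (h : IsReduced (a :: ω)) :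
    IsDescent a (wordProd (a :: ω)) := by
  rw [wordProd_cons]
  refine isDescent_simpleReflection_mul a ω fun hd => ?_
  obtain ⟨u, hu, hu'⟩ := hd.exists_word rfl
  have := h u (by rw [hu', wordProd_cons])
  simp at this
  omega

/-- Were `a` not a descent, it would be one of r_a g, with g the product of `ω`. A word for r_a g no
longer than `ω` could then be shortened by exchange to a word for g shorter than `ω`. -/
theorem IsReduced.isDescent_of_not_cons {a : Fin n} {ω : List (Fin n)} (h : IsReduced ω)
    (ha : ¬ IsReduced (a :: ω)) : IsDescent a (wordProd ω) := by
  by_contra hd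
  unfold IsReduced at ha
  push Not at ha
  obtain ⟨ω', hω', hlen⟩ := ha
  rw [wordProd_cons] at hω'
  obtain ⟨u, hu, hu'⟩ := (isDescent_simpleReflection_mul a ω hd).exists_word hω'
  have := h u (by rw [hu', simpleReflection_mul_cancel_left])
  simp at hlen
  omega

theorem IsReduced.of_length_le {ω ω' : List (Fin n)} (h : IsReduced ω)
    (hp : wordProd ω' = wordProd ω) (hl : ω'.length ≤ ω.length) : IsReduced ω' :=
  fun u hu => hl.trans (h u (hu.trans hp))

theorem isDescent_mul_iff (a b : Fin n) (g : Lattice n ≃ₗ[ℤ] Lattice n) :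
    IsDescent b (simpleReflection a * g) ↔
      height (g⁻¹ (simpleReflection a (simpleRoot b))) < 0 := by
  rw [IsDescent, mul_inv_rev, simpleReflection_inv, LinearEquiv.mul_apply]

/-- The rank two computations here and below serve twice: they give the braid relations in W(B_n),
and they show which letters remain descents when a word is peeled from the left. -/
theorem simpleReflection_simpleRoot_of_comm {a b : Fin n} (h : a.val + 1 < b.val) :
    simpleReflection a (simpleRoot b) = simpleRoot b ∧
      simpleReflection b (simpleRoot a) = simpleRoot a := by
  constructor <;> ext k <;> rw [simpleReflection_apply] <;> unfold simpleRoot <;>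
    split_ifs <;>
    simp only [Pi.single_apply, Pi.sub_apply, Fin.ext_iff, Equiv.swap_apply_def, prev] at * <;>
    grind

theorem simpleReflection_simpleRoot_of_adj {a b : Fin n} (ha : a.val ≠ 0)
    (h : b.val = a.val + 1) :
    simpleReflection a (simpleRoot b) = simpleRoot a + simpleRoot b ∧
      simpleReflection b (simpleRoot a) = simpleRoot a + simpleRoot b := by
  constructor <;> ext k <;> rw [simpleReflection_apply, Pi.add_apply] <;> unfold simpleRoot <;>
    split_ifs <;>
    simp only [Pi.single_apply, Pi.sub_apply, Fin.ext_iff, Equiv.swap_apply_def, prev] at * <;>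
    grind

theorem simpleReflection_simpleRoot_zero_one {a b : Fin n} (ha : a.val = 0) (hb : b.val = 1) :
    simpleReflection a (simpleRoot b) = simpleRoot a + simpleRoot b ∧
      simpleReflection b (simpleRoot a) = simpleRoot a + (2 : ℤ) • simpleRoot b := by
  constructor <;> ext k <;> rw [simpleReflection_apply, Pi.add_apply] <;> unfold simpleRoot <;>
    split_ifs <;>
    simp only [Pi.smul_apply, Pi.single_apply, Pi.sub_apply, Fin.ext_iff, Equiv.swap_apply_def,
      prev] at * <;>
    grind

theorem simpleReflection_comm {a b : Fin n} (h : a.val + 1 < b.val) :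
    simpleReflection a * simpleReflection b = simpleReflection b * simpleReflection a := by
  ext x k
  simp only [LinearEquiv.mul_apply, simpleReflection_apply]
  split_ifs <;> simp only [Fin.ext_iff, Equiv.swap_apply_def, prev] at * <;> grind

/-- r_a r_b takes α_a to α_b, hence conjugates r_a into r_b. -/
theorem simpleReflection_braid {a b : Fin n} (ha : a.val ≠ 0) (h : b.val = a.val + 1) :
    simpleReflection a * (simpleReflection b * simpleReflection a) =
      simpleReflection b * (simpleReflection a * simpleReflection b) := by
  have := wordProd_mul_simpleReflection [a, b] b a (by
    have h1 := simpleReflection_simpleRoot_of_adj ha h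
    simp [LinearEquiv.mul_apply, h1, simpleReflection_simpleRoot])
  simpa [mul_assoc] using this

/-- r_0 r_1 r_0 fixes α_1, hence commutes with r_1. -/
theorem simpleReflection_braid_zero_one {a b : Fin n} (ha : a.val = 0) (hb : b.val = 1) :
    simpleReflection a * (simpleReflection b * (simpleReflection a * simpleReflection b)) =
      simpleReflection b * (simpleReflection a * (simpleReflection b * simpleReflection a)) := by
  have := wordProd_mul_simpleReflection [a, b, a] b b (by
    obtain ⟨h1, h2⟩ := simpleReflection_simpleRoot_zero_one ha hb
    simp only [wordProd_cons, wordProd_nil, mul_one, LinearEquiv.mul_apply, h1, h2, map_add,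
      map_neg, map_zsmul, simpleReflection_simpleRoot]
    module)
  simpa [mul_assoc] using this

end Words

/-! ### Spanning: straightening modulo fewer factors ψ. -/

section Spanning

variable {K : Type*} [Field K] {l : ℕ} {q : Kˣ} {lam : Fin l → Kˣ} {n : ℕ}
  {β : StableFinset q lam n}

theorem tupleAct_tupleAct (a : Fin n) (i : Fin n → Kˣ) : tupleAct a (tupleAct a i) = i := by
  unfold tupleAct
  split_ifs with h
  · simp
  · ext k; simp

theorem StableFinset.act_act (a : Fin n) (i : β.Idx) : β.act a (β.act a i) = i :=
  Subtype.ext (tupleAct_tupleAct a i.1)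

theorem V.sum_e : ∑ i : β.Idx, V.e β i = 1 := by
  simpa [V.e, V.gen] using RingQuot.mkAlgHom_rel K (Rel.e_sum (β := β))

theorem V.e_mul_self (i : β.Idx) : V.e β i * V.e β i = V.e β i := by
  simpa [V.e, V.gen] using RingQuot.mkAlgHom_rel K (Rel.e_idem i)

theorem V.e_mul_of_ne {i j : β.Idx} (h : i ≠ j) : V.e β i * V.e β j = 0 := by
  simpa [V.e, V.gen] using RingQuot.mkAlgHom_rel K (Rel.e_orth i j h)

theorem V.y_mul_y (j k : Fin n) : V.y β j * V.y β k = V.y β k * V.y β j := by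
  simpa [V.y, V.gen] using RingQuot.mkAlgHom_rel K (Rel.y_comm (β := β) j k)

theorem V.y_mul_e (j : Fin n) (i : β.Idx) : V.y β j * V.e β i = V.e β i * V.y β j := by
  simpa [V.y, V.e, V.gen] using RingQuot.mkAlgHom_rel K (Rel.y_e j i)

theorem V.psi_mul_e (a : Fin n) (i : β.Idx) :
    V.psi β a * V.e β i = V.e β (β.act a i) * V.psi β a := by
  simpa [V.psi, V.e, V.gen] using RingQuot.mkAlgHom_rel K (Rel.psi_e a i)

theorem V.e_mul_psi (a : Fin n) (i : β.Idx) :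
    V.e β i * V.psi β a = V.psi β a * V.e β (β.act a i) := by
  rw [V.psi_mul_e, StableFinset.act_act]

theorem V.psi_comm (a b : Fin n) (h : a.val + 1 < b.val) :
    V.psi β a * V.psi β b = V.psi β b * V.psi β a := by
  simpa [V.psi, V.gen] using
    RingQuot.mkAlgHom_rel K (Rel.psi_comm (β := β) a b (by omega) (Or.inl h))

theorem V.psi_zero_one (a b : Fin n) (ha : a.val = 0) (hb : b.val = 1) :
    (V.psi β a * V.psi β b) ^ 2 = (V.psi β b * V.psi β a) ^ 2 := by
  have := RingQuot.mkAlgHom_rel K (Rel.psi_zero_one (β := β) a b ha hb)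
  rw [map_sub, map_zero, sub_eq_zero] at this
  simpa [V.psi, V.gen] using this

/-- The number of factors `ψ_a` that a generator contributes. -/
def Gen.psiDegree : Gen β → ℕ
  | .psi _ => 1
  | _ => 0

/-- The product of a list of generators. -/
def V.genProd (L : List (Gen β)) : V β := (L.map (V.gen β)).prod

/-- The span of the products of generators with fewer than `k` factors `ψ_a`. -/
def V.filtration (β : StableFinset q lam n) (k : ℕ) : Submodule K (V β) :=
  Submodule.span K {x | ∃ L : List (Gen β), (L.map Gen.psiDegree).sum < k ∧ V.genProd L = x}

theorem V.genProd_mem {L : List (Gen β)} {k : ℕ} (h : (L.map Gen.psiDegree).sum < k) :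
    V.genProd L ∈ V.filtration β k :=
  Submodule.subset_span ⟨L, h, rfl⟩

theorem V.filtration_mono {j k : ℕ} (h : j ≤ k) : V.filtration β j ≤ V.filtration β k :=
  Submodule.span_mono fun _ ⟨L, hL, hx⟩ => ⟨L, hL.trans_le h, hx⟩

/-- The index is a strict bound: at most j - 1 and at most k - 1 factors ψ multiply to at most j + k
- 2, which is less than m. In particular index 1 means no ψ at all. -/
theorem V.mul_mem_filtration {j k m : ℕ} {x z : V β} (hx : x ∈ V.filtration β j)
    (hz : z ∈ V.filtration β k) (h : j + k ≤ m + 1) : x * z ∈ V.filtration β m := by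
  have hxz := Submodule.mul_mem_mul hx hz
  rw [V.filtration, V.filtration, Submodule.span_mul_span] at hxz
  refine Submodule.span_le.2 ?_ hxz
  rintro _ ⟨_, ⟨L, hL, rfl⟩, _, ⟨L', hL', rfl⟩, rfl⟩
  refine Submodule.subset_span ⟨L ++ L', ?_, by simp [V.genProd]⟩
  rw [List.map_append, List.sum_append]
  omega

theorem V.gen_mem_filtration (g : Gen β) : V.gen β g ∈ V.filtration β (g.psiDegree + 1) := by
  simpa [V.genProd] using V.genProd_mem (L := [g]) (k := g.psiDegree + 1) (by simp)

theorem V.psi_mem_filtration (a : Fin n) : V.psi β a ∈ V.filtration β 2 :=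
  V.gen_mem_filtration (Gen.psi a)

theorem V.y_mem_filtration (j : Fin n) : V.y β j ∈ V.filtration β 1 :=
  V.gen_mem_filtration (Gen.y j)

theorem V.e_mem_filtration (i : β.Idx) : V.e β i ∈ V.filtration β 1 :=
  V.gen_mem_filtration (Gen.e i)

theorem V.one_mem_filtration : (1 : V β) ∈ V.filtration β 1 := by
  simpa [V.genProd] using V.genProd_mem (β := β) (L := []) (k := 1) (by simp)

theorem V.psiWord_cons (a : Fin n) (ω : List (Fin n)) :
    V.psiWord β (a :: ω) = V.psi β a * V.psiWord β ω := by
  simp [V.psiWord]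

theorem V.psiWord_mem_filtration (ω : List (Fin n)) :
    V.psiWord β ω ∈ V.filtration β (ω.length + 1) := by
  induction ω with
  | nil => simpa [V.psiWord] using V.one_mem_filtration
  | cons a ω ih =>
    rw [V.psiWord_cons]
    exact V.mul_mem_filtration (V.psi_mem_filtration a) ih (by simp; omega)

/-- Membership may be tested after multiplication by the idempotents. -/
theorem V.mem_of_mul_e_mem {S : Submodule K (V β)} {x : V β} (h : ∀ i, x * V.e β i ∈ S) :
    x ∈ S := by
  rw [← mul_one x, ← V.sum_e, Finset.mul_sum]
  exact Submodule.sum_mem _ fun i _ => h i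

theorem V.psi_sq_mem_filtration (a : Fin n) : V.psi β a * V.psi β a ∈ V.filtration β 1 := by
  have yy : ∀ j k, V.y β j - V.y β k ∈ V.filtration β 1 := fun j k =>
    Submodule.sub_mem _ (V.y_mem_filtration j) (V.y_mem_filtration k)
  by_cases ha : a.val = 0
  · have := RingQuot.mkAlgHom_rel K (Rel.psi_zero_sq (β := β) a ha)
    rw [sq, map_mul, map_one] at this
    change V.psi β a * V.psi β a = 1 at this
    rw [this]
    exact V.one_mem_filtration
  refine V.mem_of_mul_e_mem fun i => ?_
  have key : ∀ z : FreeAlgebra K (Gen β), Rel β (Free.ψ β a ^ 2 * Free.e β i) z →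
      V.psi β a * V.psi β a * V.e β i = RingQuot.mkAlgHom K (Rel β) z := fun z hz => by
    have := RingQuot.mkAlgHom_rel K hz
    rw [sq, map_mul, map_mul] at this
    exact this
  by_cases h0 : i.1 (prev a) = i.1 a
  · rw [key _ (Rel.psi_sq_eq a ha i h0), map_zero]
    exact Submodule.zero_mem _
  by_cases h1 : i.1 a = q ^ (2 : ℤ) * i.1 (prev a) <;>
    by_cases h2 : i.1 a = q ^ (-2 : ℤ) * i.1 (prev a)
  · rw [key _ (Rel.psi_sq_both a ha i ⟨h1, h2⟩), map_mul, map_mul, map_sub, map_sub]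
    exact V.mul_mem_filtration (V.mul_mem_filtration (m := 1) (yy a (prev a)) (yy (prev a) a)
      le_rfl) (V.e_mem_filtration i) le_rfl
  · rw [key _ (Rel.psi_sq_to a ha i ⟨h1, h2⟩), map_mul, map_sub]
    exact V.mul_mem_filtration (yy a (prev a)) (V.e_mem_filtration i) le_rfl
  · rw [key _ (Rel.psi_sq_from a ha i ⟨h2, h1⟩), map_mul, map_sub]
    exact V.mul_mem_filtration (yy (prev a) a) (V.e_mem_filtration i) le_rfl
  · rw [key _ (Rel.psi_sq_none a ha i ⟨h0, h1, h2⟩)]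
    exact V.e_mem_filtration i

theorem V.braid_mem_filtration (b c : Fin n) (hb : b.val ≠ 0) (hc : c.val = b.val + 1) :
    V.psi β b * V.psi β c * V.psi β b - V.psi β c * V.psi β b * V.psi β c ∈
      V.filtration β 1 := by
  refine V.mem_of_mul_e_mem fun i => ?_
  have key : ∀ z : FreeAlgebra K (Gen β),
      Rel β ((Free.ψ β b * Free.ψ β c * Free.ψ β b - Free.ψ β c * Free.ψ β b * Free.ψ β c) *
        Free.e β i) z →
      (V.psi β b * V.psi β c * V.psi β b - V.psi β c * V.psi β b * V.psi β c) * V.e β i =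
        RingQuot.mkAlgHom K (Rel β) z := fun z hz => by
    have := RingQuot.mkAlgHom_rel K hz
    simp only [map_mul, map_sub] at this
    exact this
  by_cases h : i.1 (prev b) = i.1 c ∧ (ArrowTo q (i.1 c) (i.1 b) ∨ ArrowFrom q (i.1 c) (i.1 b) ∨
      ArrowBoth q (i.1 c) (i.1 b))
  · obtain ⟨h, h' | h' | h'⟩ := h
    · rw [key _ (Rel.braid_to b c hb hc i h h')]
      exact V.e_mem_filtration i
    · rw [key _ (Rel.braid_from b c hb hc i h h'), map_neg]
      exact Submodule.neg_mem _ (V.e_mem_filtration i)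
    · rw [key _ (Rel.braid_both b c hb hc i h h'), two_mul]
      simp only [map_mul, map_sub, map_add]
      have hy := V.y_mem_filtration (β := β)
      exact V.mul_mem_filtration (Submodule.add_mem _ (Submodule.sub_mem _ (hy c)
        (Submodule.add_mem _ (hy b) (hy b))) (hy (prev b))) (V.e_mem_filtration i) le_rfl
  · rw [key _ (Rel.braid_else b c hb hc i h), map_zero]
    exact Submodule.zero_mem _

/-- The subalgebra generated by `y_1, …, y_n`. -/
def V.ySubalgebra (β : StableFinset q lam n) : Subalgebra K (V β) :=
  Algebra.adjoin K (Set.range (V.y β))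

theorem V.y_mem_ySubalgebra (j : Fin n) : V.y β j ∈ V.ySubalgebra β :=
  Algebra.subset_adjoin ⟨j, rfl⟩

theorem V.mem_filtration_of_mem_ySubalgebra {p : V β} (hp : p ∈ V.ySubalgebra β) :
    p ∈ V.filtration β 1 := by
  induction hp using Algebra.adjoin_induction with
  | mem x hx => obtain ⟨j, rfl⟩ := hx; exact V.y_mem_filtration j
  | algebraMap r =>
    rw [Algebra.algebraMap_eq_smul_one]
    exact Submodule.smul_mem _ _ V.one_mem_filtration
  | add x y _ _ hx hy => exact Submodule.add_mem _ hx hy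
  | mul x y _ _ hx hy => exact V.mul_mem_filtration hx hy le_rfl

theorem V.e_comm_of_mem_ySubalgebra {p : V β} (hp : p ∈ V.ySubalgebra β) (i : β.Idx) :
    V.e β i * p = p * V.e β i := by
  induction hp using Algebra.adjoin_induction with
  | mem x hx => obtain ⟨j, rfl⟩ := hx; exact (V.y_mul_e j i).symm
  | algebraMap r => exact (Algebra.commutes r _).symm
  | add x y _ _ hx hy => rw [mul_add, add_mul, hx, hy]
  | mul x y _ _ hx hy => rw [← mul_assoc, hx, mul_assoc, hy, mul_assoc]

/-- Only the twisted commutation matters for spanning; the correction ±e(i) for equal neighbours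
contains no ψ. -/
theorem V.exists_psi_mul_y (a j : Fin n) :
    ∃ p ∈ V.ySubalgebra β, V.psi β a * V.y β j - p * V.psi β a ∈ V.filtration β 1 := by
  by_cases ha : a.val = 0
  · by_cases hj : j.val = 0
    · obtain rfl : j = a := Fin.ext (by omega)
      refine ⟨-V.y β j, neg_mem (V.y_mem_ySubalgebra j), ?_⟩
      have := RingQuot.mkAlgHom_rel K (Rel.psi_zero_y_one (β := β) j ha)
      rw [map_zero, map_add, map_mul, map_mul] at this
      change V.psi β j * V.y β j + V.y β j * V.psi β j = 0 at this
      rw [neg_mul (V.y β j), sub_neg_eq_add, this]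
      exact Submodule.zero_mem _
    · refine ⟨V.y β j, V.y_mem_ySubalgebra j, ?_⟩
      have := RingQuot.mkAlgHom_rel K (Rel.psi_zero_y (β := β) a j ha hj)
      rw [map_mul, map_mul] at this
      change V.psi β a * V.y β j = V.y β j * V.psi β a at this
      rw [this, sub_self]
      exact Submodule.zero_mem _
  · refine ⟨V.y β (Equiv.swap (prev a) a j), V.y_mem_ySubalgebra _, ?_⟩
    refine V.mem_of_mul_e_mem fun i => ?_
    have key : ∀ z : FreeAlgebra K (Gen β),
        Rel β ((Free.ψ β a * Free.y β j - Free.y β (Equiv.swap (prev a) a j) * Free.ψ β a) *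
          Free.e β i) z →
        (V.psi β a * V.y β j - V.y β (Equiv.swap (prev a) a j) * V.psi β a) * V.e β i =
          RingQuot.mkAlgHom K (Rel β) z := fun z hz => by
      have := RingQuot.mkAlgHom_rel K hz
      simp only [map_mul, map_sub] at this
      exact this
    by_cases h : (j = prev a ∨ j = a) ∧ i.1 (prev a) = i.1 a
    · obtain ⟨rfl | rfl, h⟩ := h
      · rw [key (-Free.e β i) (by simpa using Rel.psi_y_left a ha i h), map_neg]
        exact Submodule.neg_mem _ (V.e_mem_filtration i)
      · rw [key (Free.e β i) (by simpa using Rel.psi_y_right j ha i h)]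
        exact V.e_mem_filtration i
    · rw [key _ (Rel.psi_y_else a ha j i h), map_zero]
      exact Submodule.zero_mem _

theorem V.exists_psi_mul_ySubalgebra (a : Fin n) {p : V β} (hp : p ∈ V.ySubalgebra β) :
    ∃ p' ∈ V.ySubalgebra β, V.psi β a * p - p' * V.psi β a ∈ V.filtration β 1 := by
  induction hp using Algebra.adjoin_induction with
  | mem x hx => obtain ⟨j, rfl⟩ := hx; exact V.exists_psi_mul_y a j
  | algebraMap r =>
    refine ⟨_, Subalgebra.algebraMap_mem _ r, ?_⟩
    rw [Algebra.commutes, sub_self]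
    exact Submodule.zero_mem _
  | add x y _ _ hx hy =>
    obtain ⟨x', hx', hx⟩ := hx
    obtain ⟨y', hy', hy⟩ := hy
    refine ⟨x' + y', add_mem hx' hy', ?_⟩
    convert Submodule.add_mem _ hx hy using 1
    rw [mul_add, add_mul]
    abel
  | mul x y hxY hyY hx hy =>
    obtain ⟨x', hx', hx⟩ := hx
    obtain ⟨y', hy', hy⟩ := hy
    refine ⟨x' * y', mul_mem hx' hy', ?_⟩
    have h1 := V.mul_mem_filtration (m := 1) hx (V.mem_filtration_of_mem_ySubalgebra hyY) le_rfl
    have h2 := V.mul_mem_filtration (m := 1) (V.mem_filtration_of_mem_ySubalgebra hx') hy le_rfl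
    convert Submodule.add_mem _ h1 h2 using 1
    rw [sub_mul, mul_sub]
    simp only [mul_assoc]
    abel

/-- The span of the elements `p ψ_ω e(i)` with `p` a polynomial in the `y_j` and `ω` of
length `k`. -/
def V.wordSpan (β : StableFinset q lam n) (k : ℕ) : Submodule K (V β) :=
  Submodule.span K {x | ∃ p ∈ V.ySubalgebra β, ∃ (ω : List (Fin n)) (i : β.Idx),
    ω.length = k ∧ p * V.psiWord β ω * V.e β i = x}

theorem V.exists_e_mul_psiWord (ω : List (Fin n)) (j : β.Idx) :
    ∃ j', V.e β j * V.psiWord β ω = V.psiWord β ω * V.e β j' := by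
  induction ω generalizing j with
  | nil => exact ⟨j, by simp [V.psiWord]⟩
  | cons a ω ih =>
    obtain ⟨j', h⟩ := ih (β.act a j)
    exact ⟨j', by rw [V.psiWord_cons, ← mul_assoc, V.e_mul_psi, mul_assoc, h, mul_assoc]⟩

/-- Straightening: generators are multiplied on from the left one at a time. A new ψ passes the
polynomial up to lower terms, a new y joins it, and a new idempotent travels through to the right
end, where it meets e(i) and either agrees with it or gives zero. -/
theorem V.genProd_mem_wordSpan_sup (L : List (Gen β)) :
    V.genProd L ∈ V.wordSpan β (L.map Gen.psiDegree).sum ⊔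
      V.filtration β (L.map Gen.psiDegree).sum := by
  induction L with
  | nil =>
    refine Submodule.mem_sup_left (V.mem_of_mul_e_mem fun i => ?_)
    exact Submodule.subset_span ⟨1, one_mem _, [], i, rfl, by simp [V.psiWord, V.genProd]⟩
  | cons g L ih =>
    obtain ⟨x, hx, z, hz, hxz⟩ := Submodule.mem_sup.1 ih
    have hg : V.genProd (g :: L) = V.gen β g * x + V.gen β g * z := by
      rw [← mul_add, hxz]; simp [V.genProd]
    rw [hg, List.map_cons, List.sum_cons]
    refine Submodule.add_mem _ ?_ (Submodule.mem_sup_right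
      (V.mul_mem_filtration (V.gen_mem_filtration g) hz (by omega)))
    clear hg hxz hz
    generalize (L.map Gen.psiDegree).sum = k at *
    induction hx using Submodule.span_induction with
    | zero => rw [mul_zero]; exact Submodule.zero_mem _
    | add x y _ _ hx hy => rw [mul_add]; exact Submodule.add_mem _ hx hy
    | smul r x _ hx => rw [mul_smul_comm]; exact Submodule.smul_mem _ r hx
    | mem x hx =>
      obtain ⟨p, hp, ω, i, hω, rfl⟩ := hx
      cases g with
      | psi a =>
        obtain ⟨p', hp', h⟩ := V.exists_psi_mul_ySubalgebra a hp
        have h1 := V.mul_mem_filtration (m := k + 1) (V.mul_mem_filtration (m := k + 1) h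
          (V.psiWord_mem_filtration ω) (by omega)) (V.e_mem_filtration i) le_rfl
        have h2 : p' * V.psiWord β (a :: ω) * V.e β i ∈ V.wordSpan β (k + 1) :=
          Submodule.subset_span ⟨p', hp', a :: ω, i, by simp [hω], rfl⟩
        have h3 : V.psi β a * (p * V.psiWord β ω * V.e β i) =
            p' * V.psiWord β (a :: ω) * V.e β i +
              (V.psi β a * p - p' * V.psi β a) * V.psiWord β ω * V.e β i := by
          rw [V.psiWord_cons, sub_mul, sub_mul]
          simp only [mul_assoc]
          abel
        rw [Gen.psiDegree, add_comm 1]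
        change V.psi β a * _ ∈ _
        rw [h3]
        exact Submodule.add_mem _ (Submodule.mem_sup_left h2) (Submodule.mem_sup_right h1)
      | y j =>
        refine Submodule.mem_sup_left (Submodule.subset_span
          ⟨V.y β j * p, mul_mem (V.y_mem_ySubalgebra j) hp, ω, i, by simpa [Gen.psiDegree], ?_⟩)
        simp only [mul_assoc, V.y]
      | e j =>
        change V.e β j * _ ∈ _
        obtain ⟨j', hj'⟩ := V.exists_e_mul_psiWord ω j
        rw [← mul_assoc, ← mul_assoc, V.e_comm_of_mem_ySubalgebra hp, mul_assoc p, hj', mul_assoc,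
          mul_assoc]
        by_cases h : j' = i
        · subst h
          rw [V.e_mul_self]
          refine Submodule.mem_sup_left (Submodule.subset_span
            ⟨p, hp, ω, j', by simpa [Gen.psiDegree], ?_⟩)
          simp only [mul_assoc]
        · rw [V.e_mul_of_ne h, mul_zero, mul_zero]
          exact Submodule.zero_mem _

/-- For two descents `a < b` of `g` there are two words for `g`, one that starts with `a` and one
that starts with `b`, which are related by a braid relation. -/
theorem exists_braid_words {a b : Fin n} (hab : a.val < b.val) {ω : List (Fin n)}
    (ha : IsDescent a (wordProd ω)) (hb : IsDescent b (wordProd ω)) :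
    ∃ u v : List (Fin n), u.length + 1 = ω.length ∧ v.length + 1 = ω.length ∧
      wordProd (a :: u) = wordProd ω ∧ wordProd (b :: v) = wordProd ω ∧
      V.psiWord β (a :: u) - V.psiWord β (b :: v) ∈ V.filtration β ω.length := by
  obtain ⟨u₁, hl₁, hu₁⟩ := ha.exists_word rfl
  unfold IsDescent at ha hb
  have cancel : ∀ {c : Fin n} {g g' : Lattice n ≃ₗ[ℤ] Lattice n}, g' = simpleReflection c * g →
      simpleReflection c * g' = g := by
    rintro c g g' rfl
    exact simpleReflection_mul_cancel_left c g
  -- In all three cases `a` and `b` are peeled off alternately. The letters already removed carry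
  -- the next simple root to a combination of α_a and α_b with nonnegative coefficients, not both
  -- zero. As g⁻¹ makes both negative, the next letter is again a descent, until one side of the
  -- braid relation is used up.
  by_cases hfar : a.val + 1 < b.val
  · have h2 : IsDescent b (wordProd u₁) := by
      rw [hu₁, isDescent_mul_iff, (simpleReflection_simpleRoot_of_comm hfar).1]
      exact hb
    obtain ⟨u₂, hl₂, hu₂⟩ := h2.exists_word rfl
    have hw : wordProd (a :: b :: u₂) = wordProd ω := by
      rw [wordProd_cons, wordProd_cons, cancel hu₂, cancel hu₁]
    refine ⟨b :: u₂, a :: u₂, by simp; omega, by simp; omega, hw, ?_, ?_⟩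
    · rw [← hw]
      simp only [wordProd_cons, ← mul_assoc, simpleReflection_comm hfar]
    · simp only [V.psiWord_cons, ← mul_assoc, V.psi_comm a b hfar, sub_self]
      exact Submodule.zero_mem _
  have hadj : b.val = a.val + 1 := by omega
  by_cases h0 : a.val = 0
  · have hb1 : b.val = 1 := by omega
    obtain ⟨e1, e2⟩ := simpleReflection_simpleRoot_zero_one h0 hb1
    have h2 : IsDescent b (wordProd u₁) := by
      rw [hu₁, isDescent_mul_iff, e1, map_add, height_add]
      omega
    obtain ⟨u₂, hl₂, hu₂⟩ := h2.exists_word rfl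
    have h3 : IsDescent a (wordProd u₂) := by
      have : simpleReflection a (simpleReflection b (simpleRoot a)) =
          simpleRoot a + (2 : ℤ) • simpleRoot b := by
        rw [e2, map_add, map_zsmul, e1, simpleReflection_simpleRoot]
        module
      rw [hu₂, hu₁, isDescent_mul_iff, mul_inv_rev, simpleReflection_inv, LinearEquiv.mul_apply,
        this, map_add, map_zsmul, height_add, height_smul]
      omega
    obtain ⟨u₃, hl₃, hu₃⟩ := h3.exists_word rfl
    have h4 : IsDescent b (wordProd u₃) := by
      have : simpleReflection a (simpleReflection b (simpleReflection a (simpleRoot b))) =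
          simpleRoot b := by
        rw [e1, map_add, e2, simpleReflection_simpleRoot, add_assoc, ← sub_eq_add_neg, map_add,
          map_sub, map_zsmul, e1, simpleReflection_simpleRoot]
        module
      rw [hu₃, hu₂, hu₁, isDescent_mul_iff, mul_inv_rev, mul_inv_rev, simpleReflection_inv,
        simpleReflection_inv, LinearEquiv.mul_apply, LinearEquiv.mul_apply, this]
      exact hb
    obtain ⟨u₄, hl₄, hu₄⟩ := h4.exists_word rfl
    have hw : wordProd (a :: b :: a :: b :: u₄) = wordProd ω := by
      rw [wordProd_cons, wordProd_cons, wordProd_cons, wordProd_cons, cancel hu₄, cancel hu₃,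
        cancel hu₂, cancel hu₁]
    refine ⟨b :: a :: b :: u₄, a :: b :: a :: u₄, by simp; omega, by simp; omega, hw, ?_, ?_⟩
    · rw [← hw]
      have := congrArg (· * wordProd u₄) (simpleReflection_braid_zero_one h0 hb1)
      simp only [wordProd_cons, mul_assoc] at this ⊢
      exact this.symm
    · have := congrArg (· * V.psiWord β u₄) (V.psi_zero_one (β := β) a b h0 hb1)
      simp only [V.psiWord_cons, sq, mul_assoc] at this ⊢
      rw [this, sub_self]
      exact Submodule.zero_mem _
  · obtain ⟨e1, e2⟩ := simpleReflection_simpleRoot_of_adj h0 hadj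
    have h2 : IsDescent b (wordProd u₁) := by
      rw [hu₁, isDescent_mul_iff, e1, map_add, height_add]
      omega
    obtain ⟨u₂, hl₂, hu₂⟩ := h2.exists_word rfl
    have h3 : IsDescent a (wordProd u₂) := by
      have : simpleReflection a (simpleReflection b (simpleRoot a)) = simpleRoot b := by
        rw [e2, map_add, e1, simpleReflection_simpleRoot]
        abel
      rw [hu₂, hu₁, isDescent_mul_iff, mul_inv_rev, simpleReflection_inv, LinearEquiv.mul_apply,
        this]
      exact hb
    obtain ⟨u₃, hl₃, hu₃⟩ := h3.exists_word rfl
    have hw : wordProd (a :: b :: a :: u₃) = wordProd ω := by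
      rw [wordProd_cons, wordProd_cons, wordProd_cons, cancel hu₃, cancel hu₂, cancel hu₁]
    refine ⟨b :: a :: u₃, a :: b :: u₃, by simp; omega, by simp; omega, hw, ?_, ?_⟩
    · rw [← hw]
      have := congrArg (· * wordProd u₃) (simpleReflection_braid h0 hadj)
      simp only [wordProd_cons, mul_assoc] at this ⊢
      exact this.symm
    · have := V.mul_mem_filtration (m := ω.length) (V.braid_mem_filtration (β := β) a b h0 hadj)
        (V.psiWord_mem_filtration u₃) (by omega)
      simpa only [V.psiWord_cons, sub_mul, mul_assoc] using this

/-- Up to terms with fewer factors, `ψ_ω` depends only on the product of the reduced word `ω`. -/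
theorem V.psiWord_sub_mem_filtration {ω ω' : List (Fin n)} (h : IsReduced ω) (h' : IsReduced ω')
    (hp : wordProd ω = wordProd ω') :
    V.psiWord β ω - V.psiWord β ω' ∈ V.filtration β ω.length := by
  have hlen : ω.length = ω'.length := le_antisymm (h _ hp.symm) (h' _ hp)
  induction hk : ω.length generalizing ω ω' with
  | zero =>
    rw [List.length_eq_zero_iff.1 hk, List.length_eq_zero_iff.1 (hlen.symm.trans hk), sub_self]
    exact Submodule.zero_mem _
  | succ k ih =>
    have same : ∀ (c : Fin n) (u v : List (Fin n)), IsReduced (c :: u) → IsReduced (c :: v) →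
        wordProd (c :: u) = wordProd (c :: v) → u.length = k → v.length = k →
        V.psiWord β (c :: u) - V.psiWord β (c :: v) ∈ V.filtration β (k + 1) := by
      intro c u v hu hv huv hul hvl
      rw [V.psiWord_cons, V.psiWord_cons, ← mul_sub]
      rw [wordProd_cons, wordProd_cons, mul_right_inj] at huv
      exact V.mul_mem_filtration (V.psi_mem_filtration c)
        (ih hu.tail hv.tail huv (hul.trans hvl.symm) hul) (by omega)
    cases ω with
    | nil => simp at hk
    | cons a u =>
    cases ω' with
    | nil => rw [hlen] at hk; simp at hk
    | cons b v =>
    have hul : u.length = k := by simpa using hk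
    have hvl : v.length = k := by rw [hlen] at hk; simpa using hk
    have hda := h.isDescent
    have hdb := h'.isDescent
    rw [← hp] at hdb
    -- The comparison runs through two intermediate words, `a :: u`, `a :: u'`, `b :: v'`, `b :: v`.
    -- The outer pairs share their first letter and fall under induction; the middle pair is a braid
    -- relation.
    have main : ∀ u' v' : List (Fin n), u'.length + 1 = (a :: u).length →
        v'.length + 1 = (a :: u).length → wordProd (a :: u') = wordProd (a :: u) →
        wordProd (b :: v') = wordProd (a :: u) →
        V.psiWord β (a :: u') - V.psiWord β (b :: v') ∈ V.filtration β (a :: u).length →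
        V.psiWord β (a :: u) - V.psiWord β (b :: v) ∈ V.filtration β (k + 1) := by
      intro u' v' hu' hv' hpu hpv hd
      rw [hk] at hu' hv' hd
      have r1 : IsReduced (a :: u') := h.of_length_le hpu (by simp; omega)
      have r2 : IsReduced (b :: v') := h.of_length_le hpv (by simp; omega)
      have d1 := same a u u' h r1 hpu.symm hul (by omega)
      have d2 := same b v' v r2 h' (hpv.trans hp) (by omega) hvl
      convert Submodule.add_mem _ (Submodule.add_mem _ d1 hd) d2 using 1
      abel
    rcases lt_trichotomy a.val b.val with hab | hab | hab
    · obtain ⟨u', v', h1, h2, h3, h4, h5⟩ := exists_braid_words (β := β) hab hda hdb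
      exact main u' v' h1 h2 h3 h4 h5
    · obtain rfl : a = b := Fin.ext hab
      exact same a u v h h' hp hul hvl
    · obtain ⟨v', u', h1, h2, h3, h4, h5⟩ := exists_braid_words (β := β) hab hdb hda
      refine main u' v' h2 h1 h4 h3 ?_
      rw [← neg_sub]
      exact Submodule.neg_mem _ h5

/-- At the letter `a` where the word, read from the right, ceases to be reduced, `a` is a descent of
the reduced tail. The tail may be replaced by a word starting with `a`, up to fewer ψ's, and then
ψ_a² removes two factors. -/
theorem V.psiWord_mem_filtration_of_not_isReduced {ω : List (Fin n)} (h : ¬ IsReduced ω) :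
    V.psiWord β ω ∈ V.filtration β ω.length := by
  induction ω with
  | nil => exact absurd (fun _ _ => Nat.zero_le _) h
  | cons a ω ih =>
    rw [V.psiWord_cons]
    by_cases hω : IsReduced ω
    · obtain ⟨u, hu, hu'⟩ := (hω.isDescent_of_not_cons h).exists_word rfl
      have hp : wordProd (a :: u) = wordProd ω := by
        rw [wordProd_cons, hu', simpleReflection_mul_cancel_left]
      have h1 := V.psiWord_sub_mem_filtration (β := β) hω
        (hω.of_length_le hp (by simp; omega)) hp.symm
      have h2 := V.mul_mem_filtration (m := (a :: ω).length) (V.psi_mem_filtration a) h1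
        (by simp; omega)
      have h3 := V.mul_mem_filtration (m := (a :: ω).length) (V.psi_sq_mem_filtration (β := β) a)
        (V.psiWord_mem_filtration u) (by simp; omega)
      convert Submodule.add_mem _ h2 h3 using 1
      rw [V.psiWord_cons, mul_sub]
      simp only [mul_assoc]
      abel
    · exact V.mul_mem_filtration (V.psi_mem_filtration a) (ih hω) (by simp; omega)

variable {red : weylGroupB n → List (Fin n)}

theorem isReduced_of_isReducedExpression {ω : List (Fin n)} {w : weylGroupB n}
    (h : IsReducedExpression ω w) : IsReduced ω :=
  fun u hu => h.2 u (hu.trans h.1)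

/-- The span of the elements `p ψ_w e(i)` with `p` a polynomial in the `y_j` and `w` of length
less than `k`. -/
def V.reducedSpan (β : StableFinset q lam n) (red : weylGroupB n → List (Fin n)) (k : ℕ) :
    Submodule K (V β) :=
  Submodule.span K {x | ∃ p ∈ V.ySubalgebra β, ∃ (w : weylGroupB n) (i : β.Idx),
    (red w).length < k ∧ p * V.psiWord β (red w) * V.e β i = x}

theorem V.reducedSpan_mono {j k : ℕ} (h : j ≤ k) :
    V.reducedSpan β red j ≤ V.reducedSpan β red k :=
  Submodule.span_mono fun _ ⟨p, hp, w, i, hl, hx⟩ => ⟨p, hp, w, i, hl.trans_le h, hx⟩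

/-- Replacing ψ_ω by the chosen ψ_w, or discarding it if `ω` is not reduced, changes a straightened
element only by terms with fewer ψ's, which the induction on `k` covers. -/
theorem V.filtration_le_reducedSpan (hred : ∀ w, IsReducedExpression (red w) w) (k : ℕ) :
    V.filtration β k ≤ V.reducedSpan β red k := by
  induction k with
  | zero =>
    refine Submodule.span_le.2 ?_
    rintro _ ⟨L, hL, _⟩
    omega
  | succ k ih =>
    have ih' := ih.trans (V.reducedSpan_mono k.le_succ)
    refine Submodule.span_le.2 ?_
    rintro _ ⟨L, hL, rfl⟩
    rcases Nat.lt_succ_iff_lt_or_eq.1 hL with hL | hL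
    · exact ih' (V.genProd_mem hL)
    have := V.genProd_mem_wordSpan_sup L
    rw [hL] at this
    refine sup_le (Submodule.span_le.2 ?_) ih' this
    rintro _ ⟨p, hp, ω, i, hω, rfl⟩
    have hpF := V.mem_filtration_of_mem_ySubalgebra hp
    have hiF := V.e_mem_filtration i
    have sandwich : ∀ x ∈ V.filtration β k, p * x * V.e β i ∈ V.reducedSpan β red (k + 1) :=
      fun x hx => ih' (V.mul_mem_filtration (V.mul_mem_filtration (m := k) hpF hx (by omega)) hiF
        le_rfl)
    by_cases hr : IsReduced ω
    · have hw := hred ⟨wordProd ω, wordProd_mem ω⟩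
      have hr' := isReduced_of_isReducedExpression hw
      have hd := V.psiWord_sub_mem_filtration (β := β) hr hr' hw.1.symm
      rw [hω] at hd
      have h2 : p * V.psiWord β (red ⟨wordProd ω, wordProd_mem ω⟩) * V.e β i ∈
          V.reducedSpan β red (k + 1) :=
        Submodule.subset_span ⟨p, hp, _, i, by
          have := hr' ω hw.1.symm
          omega, rfl⟩
      have h3 := Submodule.add_mem _ (sandwich _ hd) h2
      rwa [mul_sub, sub_mul, sub_add_cancel] at h3
    · have := V.psiWord_mem_filtration_of_not_isReduced (β := β) hr
      rw [hω] at this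
      exact sandwich _ this

theorem V.exists_mem_filtration (x : V β) : ∃ k, x ∈ V.filtration β k := by
  obtain ⟨x, rfl⟩ := RingQuot.mkAlgHom_surjective K (Rel β) x
  induction x using FreeAlgebra.induction with
  | grade0 r =>
    refine ⟨1, ?_⟩
    rw [AlgHom.commutes, Algebra.algebraMap_eq_smul_one]
    exact Submodule.smul_mem _ _ V.one_mem_filtration
  | grade1 g => exact ⟨_, V.gen_mem_filtration g⟩
  | mul x y hx hy =>
    obtain ⟨j, hj⟩ := hx
    obtain ⟨k, hk⟩ := hy
    rw [map_mul]
    exact ⟨j + k, V.mul_mem_filtration hj hk (by omega)⟩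
  | add x y hx hy =>
    obtain ⟨j, hj⟩ := hx
    obtain ⟨k, hk⟩ := hy
    rw [map_add]
    exact ⟨j + k, Submodule.add_mem _ (V.filtration_mono (by omega) hj)
      (V.filtration_mono (by omega) hk)⟩

theorem prod_ofFn_pow_mul {M : Type*} [Monoid M] {n : ℕ} (z : Fin n → M)
    (hz : ∀ i j, z i * z j = z j * z i) (m m' : Fin n → ℕ) :
    (List.ofFn fun j => z j ^ m j).prod * (List.ofFn fun j => z j ^ m' j).prod =
      (List.ofFn fun j => z j ^ (m + m') j).prod := by
  induction n with
  | zero => simp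
  | succ n ih =>
    simp only [List.ofFn_succ, List.prod_cons]
    have ih' := ih (fun j => z j.succ) (fun i j => hz _ _) (fun j => m j.succ) (fun j => m' j.succ)
    have hc : (List.ofFn fun j : Fin n => z j.succ ^ m j.succ).prod * z 0 ^ m' 0 =
        z 0 ^ m' 0 * (List.ofFn fun j : Fin n => z j.succ ^ m j.succ).prod := by
      refine (Commute.list_prod_left _ _ fun x hx => ?_).eq
      obtain ⟨j, rfl⟩ := List.mem_ofFn.1 hx
      exact (show Commute (z j.succ) (z 0) from hz _ _).pow_pow _ _
    rw [mul_assoc, ← mul_assoc _ (z 0 ^ m' 0), hc, mul_assoc, ih', ← mul_assoc, ← pow_add]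
    rfl

theorem prod_ofFn_pow_single {M : Type*} [Monoid M] {n : ℕ} (z : Fin n → M) (j : Fin n) :
    (List.ofFn fun k => z k ^ (Pi.single j 1 : Fin n → ℕ) k).prod = z j := by
  induction n with
  | zero => exact j.elim0
  | succ n ih =>
    rw [List.ofFn_succ, List.prod_cons]
    induction j using Fin.cases with
    | zero => simp [List.ofFn_const]
    | succ j =>
      have := ih (fun k => z k.succ) j
      simpa [Pi.single_apply] using this

theorem V.mem_span_yMonomial {p : V β} (hp : p ∈ V.ySubalgebra β) :
    p ∈ Submodule.span K (Set.range (V.yMonomial β)) := by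
  rw [V.ySubalgebra, ← Subalgebra.mem_toSubmodule, Algebra.adjoin_eq_span] at hp
  refine Submodule.span_mono ?_ hp
  intro x hx
  induction hx using Submonoid.closure_induction with
  | mem x hx =>
    obtain ⟨j, rfl⟩ := hx
    exact ⟨Pi.single j 1, prod_ofFn_pow_single _ j⟩
  | one => exact ⟨0, by simp [V.yMonomial, List.ofFn_const]⟩
  | mul x y _ _ hx hy =>
    obtain ⟨m, rfl⟩ := hx
    obtain ⟨m', rfl⟩ := hy
    exact ⟨m + m', (prod_ofFn_pow_mul _ V.y_mul_y m m').symm⟩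

theorem V.span_eq_top (hred : ∀ w, IsReducedExpression (red w) w) :
    ⊤ ≤ Submodule.span K (Set.range fun t : weylGroupB n × (Fin n → ℕ) × β.Idx =>
      V.yMonomial β t.2.1 * V.psiWord β (red t.1) * V.e β t.2.2) := by
  intro x _
  obtain ⟨k, hk⟩ := V.exists_mem_filtration x
  refine Submodule.span_le.2 ?_ (V.filtration_le_reducedSpan hred k hk)
  rintro _ ⟨p, hp, w, i, _, rfl⟩
  have hp' := V.mem_span_yMonomial hp
  clear hp
  induction hp' using Submodule.span_induction with
  | zero => simp
  | add x y _ _ hx hy => rw [add_mul, add_mul]; exact Submodule.add_mem _ hx hy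
  | smul r x _ hx => rw [smul_mul_assoc, smul_mul_assoc]; exact Submodule.smul_mem _ r hx
  | mem x hx =>
    obtain ⟨m, rfl⟩ := hx
    exact Submodule.subset_span ⟨(w, m, i), rfl⟩

end Spanning

/-! ### The operators on rational functions and their quadratic relations. -/

section Representation

variable (K : Type*) [Field K] (n : ℕ)

/-- The field of rational functions in `n` variables. -/
abbrev RatFuncs : Type _ := FractionRing (MvPolynomial (Fin n) K)

variable {n}

/-- The variables of the field of rational functions. -/
noncomputable def coord (j : Fin n) : RatFuncs K n :=
  algebraMap (MvPolynomial (Fin n) K) (RatFuncs K n) (MvPolynomial.X j)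

theorem coord_ne {j k : Fin n} (h : j ≠ k) : coord K j ≠ coord K k := by
  unfold coord
  rw [(IsFractionRing.injective (MvPolynomial (Fin n) K) (RatFuncs K n)).ne_iff]
  exact (MvPolynomial.X_injective).ne h

/-- The linear form `y_{b+1} - y_b`. -/
noncomputable def rootFn (b : Fin n) : RatFuncs K n := coord K b - coord K (prev b)

theorem rootFn_ne_zero {b : Fin n} (hb : b.val ≠ 0) : rootFn K b ≠ 0 :=
  sub_ne_zero.2 (coord_ne K (prev_ne hb).symm)

/-- An automorphism of the lattice acts on polynomials by linear substitutions. -/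
noncomputable def polyAct (g : Lattice n ≃ₗ[ℤ] Lattice n) :
    MvPolynomial (Fin n) K →ₐ[K] MvPolynomial (Fin n) K :=
  MvPolynomial.aeval fun j => ∑ k, g (Pi.single j 1) k • MvPolynomial.X k

theorem polyAct_X (g : Lattice n ≃ₗ[ℤ] Lattice n) (j : Fin n) :
    polyAct K g (MvPolynomial.X j) = ∑ k, g (Pi.single j 1) k • MvPolynomial.X k := by
  simp [polyAct]

theorem polyAct_one : polyAct K (1 : Lattice n ≃ₗ[ℤ] Lattice n) = AlgHom.id K _ := by
  ext1 j
  rw [polyAct_X]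
  simp [Pi.single_apply]

theorem polyAct_mul (g h : Lattice n ≃ₗ[ℤ] Lattice n) :
    polyAct K (g * h) = (polyAct K g).comp (polyAct K h) := by
  ext1 j
  rw [AlgHom.comp_apply, polyAct_X, polyAct_X, map_sum]
  simp only [map_zsmul, polyAct_X, Finset.smul_sum, smul_smul]
  rw [Finset.sum_comm]
  refine Finset.sum_congr rfl fun k _ => ?_
  rw [← Finset.sum_smul, LinearEquiv.mul_apply]
  congr 1
  conv_lhs => rw [← Finset.univ_sum_single (h (Pi.single j 1))]
  rw [map_sum, Finset.sum_apply]
  refine Finset.sum_congr rfl fun m _ => ?_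
  have : (Pi.single m (h (Pi.single j 1) m) : Lattice n) =
      h (Pi.single j 1) m • Pi.single m 1 := by
    ext; simp [Pi.single_apply]
  rw [this, map_smul]
  rfl

/-- The action on polynomials as a group homomorphism. -/
noncomputable def polyActHom : (Lattice n ≃ₗ[ℤ] Lattice n) →*
    (MvPolynomial (Fin n) K ≃ₐ[K] MvPolynomial (Fin n) K) where
  toFun g := AlgEquiv.ofAlgHom (polyAct K g) (polyAct K g⁻¹)
    (by rw [← polyAct_mul, mul_inv_cancel, polyAct_one])
    (by rw [← polyAct_mul, inv_mul_cancel, polyAct_one])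
  map_one' := by
    ext x
    simp [polyAct_one]
  map_mul' g h := by
    ext x
    simp [polyAct_mul]

/-- The action on rational functions. -/
noncomputable def ratAct : (Lattice n ≃ₗ[ℤ] Lattice n) →* (RatFuncs K n ≃ₐ[K] RatFuncs K n) :=
  (IsFractionRing.fieldEquivOfAlgEquivHom K (RatFuncs K n)).comp (polyActHom K)

theorem ratAct_coord (g : Lattice n ≃ₗ[ℤ] Lattice n) (j : Fin n) :
    ratAct K g (coord K j) = ∑ k, g (Pi.single j 1) k • coord K k := by
  have : ratAct K g (coord K j) =
      algebraMap _ (RatFuncs K n) (polyAct K g (MvPolynomial.X j)) := by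
    simp [ratAct, coord, polyActHom]
  rw [this, polyAct_X, map_sum]
  simp only [map_zsmul]
  rfl

/-- A simple reflection acting on rational functions. -/
noncomputable def ratRefl (a : Fin n) : RatFuncs K n ≃ₐ[K] RatFuncs K n := ratAct K (simpleReflection a)

theorem ratRefl_coord (a j : Fin n) :
    ratRefl K a (coord K j) =
      if a.val = 0 then (if j = a then -coord K j else coord K j)
      else coord K (Equiv.swap (prev a) a j) := by
  rw [ratRefl, ratAct_coord, simpleReflection_single]
  split_ifs <;> simp [Pi.single_apply]

theorem ratRefl_ratRefl (a : Fin n) (x : RatFuncs K n) : ratRefl K a (ratRefl K a x) = x := by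
  rw [← AlgEquiv.mul_apply, ratRefl, ← map_mul, simpleReflection_mul_self, map_one]; rfl

theorem ratRefl_comm {a b : Fin n} (h : a.val + 1 < b.val) (x : RatFuncs K n) :
    ratRefl K a (ratRefl K b x) = ratRefl K b (ratRefl K a x) := by
  have := congrArg (ratAct K) (simpleReflection_comm h)
  simp only [map_mul] at this
  exact DFunLike.congr_fun this x

theorem ratRefl_braid {a b : Fin n} (ha : a.val ≠ 0) (h : b.val = a.val + 1) (x : RatFuncs K n) :
    ratRefl K a (ratRefl K b (ratRefl K a x)) = ratRefl K b (ratRefl K a (ratRefl K b x)) := by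
  have := congrArg (ratAct K) (simpleReflection_braid ha h)
  simp only [map_mul] at this
  exact DFunLike.congr_fun this x

theorem ratRefl_braid_zero_one {a b : Fin n} (ha : a.val = 0) (hb : b.val = 1) (x : RatFuncs K n) :
    ratRefl K a (ratRefl K b (ratRefl K a (ratRefl K b x))) = ratRefl K b (ratRefl K a (ratRefl K b (ratRefl K a x))) := by
  have := congrArg (ratAct K) (simpleReflection_braid_zero_one ha hb)
  simp only [map_mul] at this
  exact DFunLike.congr_fun this x

variable {K} {l : ℕ} {q : Kˣ} {lam : Fin l → Kˣ}

open Classical in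
/-- The factor that `ψ_b` multiplies with. -/
noncomputable def arrowFactor {L : Type*} [Field L] (q u v : Kˣ) (x : L) : L :=
  -- A single arrow contributes its linear form in one of the two directions only, so that ψ_b²
  -- contains it once; for ↔ both directions contribute.
  if u = q ^ (-2 : ℤ) * v then x else 1

theorem map_arrowFactor {L : Type*} [Field L] [Algebra K L] (s : L ≃ₐ[K] L) (u v : Kˣ) (x : L) :
    s (arrowFactor q u v x) = arrowFactor q u v (s x) := by
  unfold arrowFactor
  split_ifs <;> simp

theorem arrowFactor_ne_zero {L : Type*} [Field L] (u v : Kˣ) {x : L} (h : x ≠ 0) :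
    arrowFactor q u v x ≠ 0 := by
  unfold arrowFactor
  split_ifs
  · exact h
  · exact one_ne_zero

/-- Inverting both vertices reverses arrows, so inverting and exchanging them preserves arrows. This
compatibility with r_0 is needed for the braid relation of ψ_0 and ψ_1. -/
theorem arrowFactor_inv {L : Type*} [Field L] (u v : Kˣ) (x : L) :
    arrowFactor q v⁻¹ u⁻¹ x = arrowFactor q u v x := by
  unfold arrowFactor
  have : v⁻¹ = q ^ (-2 : ℤ) * u⁻¹ ↔ u = q ^ (-2 : ℤ) * v := by
    rw [inv_eq_iff_eq_inv, mul_inv, inv_inv, zpow_neg, inv_inv]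
    constructor <;> rintro rfl <;> simp
  by_cases h : u = q ^ (-2 : ℤ) * v
  · rw [if_pos h, if_pos (this.2 h)]
  · rw [if_neg h, if_neg (this.not.2 h)]

variable (β : StableFinset q lam n)

open Classical in
/-- The action of `ψ_a` on tuples of rational functions indexed by `β`. -/
noncomputable def psiOp (a : Fin n) : Module.End K (β.Idx → RatFuncs K n) where
  toFun f j :=
    -- No divided difference occurs even if the first entry is its own inverse: the relations of ψ_0
    -- have no exceptional case.
    if a.val = 0 then ratRefl K a (f (β.act a j))
    -- Here r_a fixes `j`, so the divided difference stays in one component. Rational functions make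
    -- the division available without a divisibility argument.
    else if j.1 (prev a) = j.1 a then
      (f j - ratRefl K a (f j)) / rootFn K a
    else arrowFactor q (j.1 (prev a)) (j.1 a) (rootFn K a) *
      ratRefl K a (f (β.act a j))
  map_add' f g := by
    ext j
    simp only [Pi.add_apply, map_add]
    split_ifs <;> ring
  map_smul' r f := by
    ext j
    simp only [Pi.smul_apply, map_smul, RingHom.id_apply]
    split_ifs
    · rfl
    · rw [← smul_sub, smul_div_assoc]
    · rw [mul_smul_comm]

/-- Multiplication by a rational function. -/
noncomputable def mulOp (z : RatFuncs K n) : Module.End K (β.Idx → RatFuncs K n) where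
  toFun f j := z * f j
  map_add' f g := by ext j; simp [mul_add]
  map_smul' r f := by ext j; simp

open Classical in
/-- The projection to a component. -/
noncomputable def eOp (i : β.Idx) : Module.End K (β.Idx → RatFuncs K n) :=
  LinearMap.single K (fun _ => RatFuncs K n) i ∘ₗ LinearMap.proj i

variable {β}

open Classical in
theorem eOp_apply (i : β.Idx) (f : β.Idx → RatFuncs K n) (j : β.Idx) :
    eOp β i f j = if j = i then f i else 0 := by
  simp [eOp, Pi.single_apply]

@[simp] theorem mulOp_apply (z : RatFuncs K n) (f : β.Idx → RatFuncs K n) (j : β.Idx) :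
    mulOp β z f j = z * f j := rfl

theorem psiOp_zero {a : Fin n} (ha : a.val = 0) (f : β.Idx → RatFuncs K n) (j : β.Idx) :
    psiOp β a f j = ratRefl K a (f (β.act a j)) := if_pos ha

theorem psiOp_eq {a : Fin n} (ha : a.val ≠ 0) (f : β.Idx → RatFuncs K n) {j : β.Idx}
    (h : j.1 (prev a) = j.1 a) :
    psiOp β a f j = (f j - ratRefl K a (f j)) / rootFn K a :=
  (if_neg ha).trans (if_pos h)

theorem psiOp_ne {a : Fin n} (ha : a.val ≠ 0) (f : β.Idx → RatFuncs K n) {j : β.Idx}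
    (h : j.1 (prev a) ≠ j.1 a) :
    psiOp β a f j =
      arrowFactor q (j.1 (prev a)) (j.1 a) (rootFn K a) *
        ratRefl K a (f (β.act a j)) :=
  (if_neg ha).trans (if_neg h)

/-- An operator that acts diagonally agrees with a multiplication on every component. -/
theorem mul_eOp_of_diagonal (X : Module.End K (β.Idx → RatFuncs K n)) (Z : β.Idx → RatFuncs K n)
    (i : β.Idx) (h : ∀ f j, X f j = Z j * f j) : X * eOp β i = mulOp β (Z i) * eOp β i := by
  refine LinearMap.ext fun f => funext fun j => ?_
  rw [Module.End.mul_apply, Module.End.mul_apply, h, mulOp_apply, eOp_apply]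
  split_ifs with hj
  · rw [hj]
  · simp

theorem StableFinset.act_zero_apply {a : Fin n} (ha : a.val = 0) (j : β.Idx) (k : Fin n) :
    (β.act a j).1 k = if k = a then (j.1 k)⁻¹ else j.1 k := by
  simp only [StableFinset.act, tupleAct, ha, if_true, Function.update_apply]
  split_ifs with h
  · rw [h]
  · rfl

theorem StableFinset.act_apply {a : Fin n} (ha : a.val ≠ 0) (j : β.Idx) (k : Fin n) :
    (β.act a j).1 k = j.1 (Equiv.swap (prev a) a k) := by
  simp [StableFinset.act, tupleAct, ha]

theorem StableFinset.act_eq_self {a : Fin n} (ha : a.val ≠ 0) {j : β.Idx}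
    (h : j.1 (prev a) = j.1 a) : β.act a j = j := by
  ext1
  funext k
  rw [StableFinset.act_apply ha, Equiv.swap_apply_def]
  split_ifs with h1 h2
  · rw [h1, h]
  · rw [h2, h]
  · rfl

theorem psiOp_mul_eOp (a : Fin n) (i : β.Idx) :
    psiOp β a * eOp β i = eOp β (β.act a i) * psiOp β a := by
  refine LinearMap.ext fun f => funext fun j => ?_
  have hiff : j = β.act a i ↔ β.act a j = i :=
    ⟨fun h => by rw [h, StableFinset.act_act], fun h => by rw [← h, StableFinset.act_act]⟩
  rw [Module.End.mul_apply, Module.End.mul_apply, eOp_apply]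
  by_cases ha : a.val = 0
  · rw [psiOp_zero ha, psiOp_zero ha, eOp_apply, StableFinset.act_act]
    by_cases hji : j = β.act a i
    · rw [if_pos hji, if_pos (hiff.1 hji)]
    · rw [if_neg hji, if_neg (hiff.not.1 hji), map_zero]
  by_cases h : j.1 (prev a) = j.1 a
  · have hj := StableFinset.act_eq_self ha h
    rw [psiOp_eq ha _ h, eOp_apply]
    rw [hj] at hiff
    by_cases hji : j = i
    · subst hji
      rw [if_pos rfl, if_pos hj.symm, hj, psiOp_eq ha _ h]
    · rw [if_neg hji, if_neg (hiff.not.2 hji)]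
      simp
  · rw [psiOp_ne ha _ h, eOp_apply]
    by_cases hji : j = β.act a i
    · rw [if_pos hji, if_pos (hiff.1 hji), ← hji, psiOp_ne ha _ h, hiff.1 hji]
    · rw [if_neg hji, if_neg (hiff.not.1 hji)]
      simp

theorem ratRefl_coord_prev {b : Fin n} (hb : b.val ≠ 0) :
    ratRefl K b (coord K (prev b)) = coord K b := by
  simp [ratRefl_coord, hb]

theorem ratRefl_coord_self {b : Fin n} (hb : b.val ≠ 0) :
    ratRefl K b (coord K b) = coord K (prev b) := by
  simp [ratRefl_coord, hb]

theorem ratRefl_rootFn {b : Fin n} (hb : b.val ≠ 0) : ratRefl K b (rootFn K b) = -rootFn K b := by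
  rw [rootFn, map_sub, ratRefl_coord_prev hb, ratRefl_coord_self hb, neg_sub]

-- The twisted Leibniz rule: for equal neighbours the correction is (y_k - y_{π(k)}) / (y_{b+1} -
-- y_b), a constant; otherwise ψ_b is semilinear and there is none.
open Classical in
theorem psiOp_mul_coord {b : Fin n} (hb : b.val ≠ 0) (k : Fin n) (f : β.Idx → RatFuncs K n)
    (j : β.Idx) :
    (psiOp β b * mulOp β (coord K k) -
        mulOp β (coord K (Equiv.swap (prev b) b k)) * psiOp β b) f j =
      (if j.1 (prev b) = j.1 b then
        (if k = prev b then -1 else if k = b then 1 else 0) else 0) * f j := by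
  have hne := rootFn_ne_zero K hb
  rw [LinearMap.sub_apply, Pi.sub_apply, Module.End.mul_apply, Module.End.mul_apply, mulOp_apply]
  by_cases h : j.1 (prev b) = j.1 b
  · rw [psiOp_eq hb _ h, psiOp_eq hb _ h, if_pos h]
    simp only [mulOp_apply, map_mul, ratRefl_coord, hb, if_false]
    split_ifs with h1 h2
    · subst h1; simp only [Equiv.swap_apply_left]; field_simp; rw [rootFn]; ring
    · subst h2; simp only [Equiv.swap_apply_right]; field_simp; rw [rootFn]; ring
    · rw [Equiv.swap_apply_of_ne_of_ne h1 h2]; field_simp; ring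
  · rw [psiOp_ne hb _ h, psiOp_ne hb _ h, if_neg h]
    simp only [mulOp_apply, map_mul, ratRefl_coord, hb, if_false]
    ring

theorem psiOp_sq_of_eq {b : Fin n} (hb : b.val ≠ 0) (f : β.Idx → RatFuncs K n) {j : β.Idx}
    (h : j.1 (prev b) = j.1 b) : (psiOp β b ^ 2) f j = 0 := by
  have hne := rootFn_ne_zero K hb
  rw [sq, Module.End.mul_apply, psiOp_eq hb _ h, psiOp_eq hb _ h]
  simp only [map_div₀, map_sub, ratRefl_ratRefl, ratRefl_rootFn hb]
  field_simp
  ring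

theorem psiOp_sq_of_ne {b : Fin n} (hb : b.val ≠ 0) (f : β.Idx → RatFuncs K n) {j : β.Idx}
    (h : j.1 (prev b) ≠ j.1 b) :
    (psiOp β b ^ 2) f j =
      arrowFactor q (j.1 (prev b)) (j.1 b) (rootFn K b) *
        arrowFactor q (j.1 b) (j.1 (prev b)) (-rootFn K b) * f j := by
  have h1 : (β.act b j).1 (prev b) = j.1 b := by simp [StableFinset.act_apply hb]
  have h2 : (β.act b j).1 b = j.1 (prev b) := by simp [StableFinset.act_apply hb]
  rw [sq, Module.End.mul_apply, psiOp_ne hb _ h, psiOp_ne hb _ (by rw [h1, h2]; exact h.symm),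
    map_mul, ratRefl_ratRefl, StableFinset.act_act, map_arrowFactor, ratRefl_rootFn hb, h1, h2,
    mul_assoc]

end Representation

/-! ### Commutation and braid relations of the operators. -/

section Braid

variable {K : Type*} [Field K] {n l : ℕ} {q : Kˣ} {lam : Fin l → Kˣ} {β : StableFinset q lam n}

set_option linter.unusedSimpArgs false in
theorem psiOp_comm {a b : Fin n} (h : a.val + 1 < b.val) :
    psiOp β a * psiOp β b = psiOp β b * psiOp β a := by
  refine LinearMap.ext fun f => funext fun j => ?_
  rw [Module.End.mul_apply, Module.End.mul_apply]
  have hb : b.val ≠ 0 := by omega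
  have n1 : b ≠ a := by simp only [Ne, Fin.ext_iff]; omega
  have n2 : prev b ≠ a := by simp only [Ne, Fin.ext_iff, prev]; omega
  have n3 : b ≠ prev a := by simp only [Ne, Fin.ext_iff, prev]; omega
  have n4 : prev b ≠ prev a := by simp only [Ne, Fin.ext_iff, prev]; omega
  have c1 : ratRefl K a (rootFn K b) = rootFn K b := by
    rw [rootFn, map_sub, ratRefl_coord, ratRefl_coord]
    simp [n1, n2, Equiv.swap_apply_of_ne_of_ne n3 n1, Equiv.swap_apply_of_ne_of_ne n4 n2]
  have c2 : ratRefl K b (rootFn K a) = rootFn K a := by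
    rw [rootFn, map_sub, ratRefl_coord, ratRefl_coord, if_neg hb, if_neg hb,
      Equiv.swap_apply_of_ne_of_ne n2.symm n1.symm, Equiv.swap_apply_of_ne_of_ne n4.symm n3.symm]
  have e3 : (β.act b j).1 a = j.1 a := by
    rw [StableFinset.act_apply hb, Equiv.swap_apply_of_ne_of_ne n2.symm n1.symm]
  have e4 : (β.act b j).1 (prev a) = j.1 (prev a) := by
    rw [StableFinset.act_apply hb, Equiv.swap_apply_of_ne_of_ne n4.symm n3.symm]
  have hne := rootFn_ne_zero K hb
  by_cases ha : a.val = 0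
  · have e1 : (β.act a j).1 b = j.1 b := by rw [StableFinset.act_zero_apply ha, if_neg n1]
    have e2 : (β.act a j).1 (prev b) = j.1 (prev b) := by
      rw [StableFinset.act_zero_apply ha, if_neg n2]
    have hact : β.act a (β.act b j) = β.act b (β.act a j) := by
      ext1; funext k
      simp only [StableFinset.act_zero_apply ha, StableFinset.act_apply hb]
      by_cases hk : k = a
      · simp [hk, Equiv.swap_apply_of_ne_of_ne n2.symm n1.symm]
      · rw [if_neg hk, if_neg]
        rwa [← Equiv.eq_symm_apply, Equiv.symm_swap,
          Equiv.swap_apply_of_ne_of_ne n2.symm n1.symm]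
    rw [psiOp_zero ha]
    by_cases h : j.1 (prev b) = j.1 b
    · rw [psiOp_eq hb _ (by rw [e1, e2, h]), psiOp_eq hb _ h, psiOp_zero ha]
      simp only [map_div₀, map_sub, c1, c2, ratRefl_comm K ‹_›]
    · rw [psiOp_ne hb _ (by rw [e1, e2]; exact h), psiOp_ne hb _ h, psiOp_zero ha, hact]
      simp only [map_mul, map_arrowFactor, c1, c2, e1, e2, ratRefl_comm K ‹_›]
  · have e1 : (β.act a j).1 b = j.1 b := by
      rw [StableFinset.act_apply ha, Equiv.swap_apply_of_ne_of_ne n3 n1]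
    have e2 : (β.act a j).1 (prev b) = j.1 (prev b) := by
      rw [StableFinset.act_apply ha, Equiv.swap_apply_of_ne_of_ne n4 n2]
    have hact : β.act a (β.act b j) = β.act b (β.act a j) := by
      ext1; funext k
      simp only [StableFinset.act_apply ha, StableFinset.act_apply hb]
      simp only [Equiv.swap_apply_def]
      grind
    have hne' := rootFn_ne_zero K ha
    by_cases h : j.1 (prev b) = j.1 b <;> by_cases h' : j.1 (prev a) = j.1 a
    · rw [psiOp_eq ha _ h', psiOp_eq hb _ h, psiOp_eq hb _ h, psiOp_eq ha _ h']
      simp only [map_div₀, map_sub, c1, c2, ratRefl_comm K ‹_›]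
      field_simp
      ring
    · rw [psiOp_ne ha _ h', psiOp_eq hb _ (by rw [e1, e2, h]), psiOp_eq hb _ h, psiOp_ne ha _ h']
      simp only [map_div₀, map_mul, map_sub, map_arrowFactor, c1, c2, ratRefl_comm K ‹_›]
      field_simp
    · rw [psiOp_eq ha _ h', psiOp_ne hb _ h, psiOp_ne hb _ h, psiOp_eq ha _ (by rw [e3, e4, h'])]
      simp only [map_div₀, map_mul, map_sub, map_arrowFactor, c1, c2, ratRefl_comm K ‹_›]
      field_simp
    · rw [psiOp_ne ha _ h', psiOp_ne hb _ (by rw [e1, e2]; exact h), psiOp_ne hb _ h,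
        psiOp_ne ha _ (by rw [e3, e4]; exact h'), hact]
      simp only [map_mul, map_arrowFactor, c1, c2, e1, e2, e3, e4, ratRefl_comm K ‹_›]
      ring

set_option linter.unusedSimpArgs false in
theorem psiOp_zero_one {a b : Fin n} (ha : a.val = 0) (hb : b.val = 1) :
    psiOp β a * psiOp β b * psiOp β a * psiOp β b =
      psiOp β b * psiOp β a * psiOp β b * psiOp β a := by
  refine LinearMap.ext fun f => funext fun j => ?_
  have hb0 : b.val ≠ 0 := by omega
  have hp : prev b = a := by simp only [Fin.ext_iff, prev]; omega
  have hba : b ≠ a := by simp only [Ne, Fin.ext_iff]; omega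
  have a1 : ∀ j : β.Idx, (β.act a j).1 a = (j.1 a)⁻¹ := fun j => by
    rw [StableFinset.act_zero_apply ha, if_pos rfl]
  have a2 : ∀ j : β.Idx, (β.act a j).1 b = j.1 b := fun j => by
    rw [StableFinset.act_zero_apply ha, if_neg hba]
  have b1 : ∀ j : β.Idx, (β.act b j).1 a = j.1 b := fun j => by
    rw [StableFinset.act_apply hb0, hp, Equiv.swap_apply_left]
  have b2 : ∀ j : β.Idx, (β.act b j).1 b = j.1 a := fun j => by
    rw [StableFinset.act_apply hb0, hp, Equiv.swap_apply_right]
  have c1 : ratRefl K a (rootFn K b) = coord K b + coord K a := by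
    rw [rootFn, hp, map_sub]
    simp [ratRefl_coord, ha, hba]
  have c2 : ratRefl K a (coord K b + coord K a) = rootFn K b := by rw [← c1, ratRefl_ratRefl]
  have c3 : ratRefl K b (rootFn K b) = -rootFn K b := ratRefl_rootFn hb0
  have c4 : ratRefl K b (coord K b + coord K a) = coord K b + coord K a := by
    rw [← hp, map_add, ratRefl_coord_prev hb0, ratRefl_coord_self hb0, add_comm]
  have hact : β.act b (β.act a (β.act b (β.act a j))) =
      β.act a (β.act b (β.act a (β.act b j))) := by
    ext1; funext k
    simp only [StableFinset.act_zero_apply ha, StableFinset.act_apply hb0, hp,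
      Equiv.swap_apply_def]
    grind
  have s1 := ratRefl_braid_zero_one K ha hb
  have hD := rootFn_ne_zero K hb0
  have hE : coord K b + coord K a ≠ 0 := by
    rw [← c1]; exact (map_ne_zero (ratRefl K a)).2 hD
  have z := fun f (j : β.Idx) => psiOp_zero (β := β) ha f j
  have e := fun f (j : β.Idx) => psiOp_eq (β := β) hb0 f (j := j)
  have d := fun f (j : β.Idx) => psiOp_ne (β := β) hb0 f (j := j)
  rw [hp] at e d
  -- With D = y_2 - y_1 and E = y_2 + y_1, r_0 exchanges D and E, while r_1 negates D and fixes E.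
  -- Nothing else about the variables is needed.
  generalize rootFn K b = D at *
  generalize coord K b + coord K a = E at *
  have i1 : ∀ u v : Kˣ, u⁻¹ = v ↔ v⁻¹ = u := fun u v => inv_eq_iff_eq_inv.trans eq_comm
  have f1 : ∀ u v : Kˣ, ∀ x : RatFuncs K n,
      arrowFactor q v⁻¹ u x = arrowFactor q u⁻¹ v x := fun u v x => by
    rw [← arrowFactor_inv, inv_inv]
  have t1 := StableFinset.act_act (β := β)
  have t2 := ratRefl_ratRefl K (n := n)
  simp only [Module.End.mul_apply]
  -- On the orbit of `j`, ψ_1 is a divided difference exactly where the first two entries agree,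
  -- which depends on whether i_1 = i_2 and whether i_1⁻¹ = i_2.
  by_cases h : j.1 a = j.1 b <;> by_cases h' : (j.1 a)⁻¹ = j.1 b
  · rw [h] at h'
    simp only [z, e, a1, a2, h, h', t1, t2, map_div₀, map_sub, map_neg, c1, c2, c3, c4, s1]
    field_simp
    ring
  · rw [h] at h'
    simp only [z, e, d, a1, a2, b1, b2, h, h', t1, t2, map_div₀, map_sub, map_mul, map_neg,
      map_arrowFactor, c1, c2, c3, c4, s1, Ne, not_false_eq_true, not_true]
    field_simp
  · have h'' := (i1 _ _).1 h'
    simp only [z, e, d, a1, a2, b1, b2, h, h', h'', f1, t1, t2, map_div₀, map_sub, map_mul, map_neg,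
      map_arrowFactor, c1, c2, c3, c4, s1, Ne, not_false_eq_true, not_true]
    field_simp
  · have h'' := (i1 _ _).not.1 h'
    have h3 : ¬ (j.1 b)⁻¹ = (j.1 a)⁻¹ := fun h4 => h (inv_injective h4).symm
    simp only [z, d, a1, a2, b1, b2, h, h', h'', h3, t1, map_mul, map_neg,
      map_arrowFactor, arrowFactor_inv, c1, c2, c3, c4, hact, s1, Ne, not_false_eq_true]
    rw [f1]
    ring

theorem rootFn_add_ne_zero {b c : Fin n} (hc : c.val = b.val + 1) :
    rootFn K b + rootFn K c ≠ 0 := by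
  have hp : prev c = b := by simp only [Fin.ext_iff, prev]; omega
  have hcp : c ≠ prev b := by simp only [Ne, Fin.ext_iff, prev]; omega
  rw [rootFn, rootFn, hp, add_comm, sub_add_sub_cancel]
  exact sub_ne_zero.2 (coord_ne K hcp)

-- The defect is diagonal. It arises only if the outer entries agree and differ from the middle one:
-- then the middle factor of each triple product is a divided difference with denominator D + E
-- after reflection. Its reflected parts cancel by the braid relation in the group, and what remains
-- are the two coefficients that ψ_b² and ψ_{b+1}² would have, divided by D + E.
set_option linter.unusedSimpArgs false in
open Classical in
theorem psiOp_braid {b c : Fin n} (hb : b.val ≠ 0) (hc : c.val = b.val + 1)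
    (f : β.Idx → RatFuncs K n) (j : β.Idx) :
    (psiOp β b * psiOp β c * psiOp β b - psiOp β c * psiOp β b * psiOp β c) f j =
      (if j.1 (prev b) = j.1 c ∧ j.1 c ≠ j.1 b then
        (arrowFactor q (j.1 c) (j.1 b) (rootFn K b) * arrowFactor q (j.1 b) (j.1 c) (-rootFn K b) -
          arrowFactor q (j.1 b) (j.1 c) (rootFn K c) *
            arrowFactor q (j.1 c) (j.1 b) (-rootFn K c)) / (rootFn K b + rootFn K c)
      else 0) * f j := by
  have hc0 : c.val ≠ 0 := by omega
  have hp : prev c = b := by simp only [Fin.ext_iff, prev]; omega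
  have hcb : c ≠ b := by simp only [Ne, Fin.ext_iff]; omega
  have hcp : c ≠ prev b := by simp only [Ne, Fin.ext_iff, prev]; omega
  have hpb := prev_ne hb
  have b0 : ∀ j : β.Idx, (β.act b j).1 (prev b) = j.1 b := fun j => by
    rw [StableFinset.act_apply hb, Equiv.swap_apply_left]
  have b1 : ∀ j : β.Idx, (β.act b j).1 b = j.1 (prev b) := fun j => by
    rw [StableFinset.act_apply hb, Equiv.swap_apply_right]
  have b2 : ∀ j : β.Idx, (β.act b j).1 c = j.1 c := fun j => by
    rw [StableFinset.act_apply hb, Equiv.swap_apply_of_ne_of_ne hcp hcb]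
  have a0 : ∀ j : β.Idx, (β.act c j).1 (prev b) = j.1 (prev b) := fun j => by
    rw [StableFinset.act_apply hc0, hp, Equiv.swap_apply_of_ne_of_ne hpb hcp.symm]
  have a1 : ∀ j : β.Idx, (β.act c j).1 b = j.1 c := fun j => by
    rw [StableFinset.act_apply hc0, hp, Equiv.swap_apply_left]
  have a2 : ∀ j : β.Idx, (β.act c j).1 c = j.1 b := fun j => by
    rw [StableFinset.act_apply hc0, hp, Equiv.swap_apply_right]
  have hact : β.act b (β.act c (β.act b j)) = β.act c (β.act b (β.act c j)) := by
    ext1; funext k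
    simp only [StableFinset.act_apply hc0, StableFinset.act_apply hb, hp, Equiv.swap_apply_def]
    grind
  have s1 := ratRefl_braid K hb hc
  have c1 : ratRefl K b (rootFn K b) = -rootFn K b := ratRefl_rootFn hb
  have c2 : ratRefl K c (rootFn K c) = -rootFn K c := ratRefl_rootFn hc0
  have c3 : ratRefl K b (rootFn K c) = rootFn K b + rootFn K c := by
    simp only [rootFn, map_sub, hp, ratRefl_coord_self hb]
    simp [ratRefl_coord, hb, Equiv.swap_apply_of_ne_of_ne hcp hcb]
  have c4 : ratRefl K c (rootFn K b) = rootFn K b + rootFn K c := by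
    have := ratRefl_coord_prev (K := K) hc0
    rw [hp] at this
    simp only [rootFn, map_sub, hp, this]
    simp [ratRefl_coord, hc0, hp, Equiv.swap_apply_of_ne_of_ne hpb hcp.symm]
  have hD := rootFn_ne_zero K hb
  have hE := rootFn_ne_zero K hc0
  have hDE := rootFn_add_ne_zero (K := K) hc
  have e := fun f (j : β.Idx) => psiOp_eq (β := β) hb f (j := j)
  have d := fun f (j : β.Idx) => psiOp_ne (β := β) hb f (j := j)
  have e' := fun f (j : β.Idx) => psiOp_eq (β := β) hc0 f (j := j)
  have d' := fun f (j : β.Idx) => psiOp_ne (β := β) hc0 f (j := j)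
  rw [hp] at e' d'
  have c5 : ratRefl K b (rootFn K b + rootFn K c) = rootFn K c := by rw [map_add, c1, c3]; ring
  have c6 : ratRefl K c (rootFn K b + rootFn K c) = rootFn K b := by rw [map_add, c2, c4]; ring
  generalize rootFn K b = D at *
  generalize rootFn K c = E at *
  have t1 := StableFinset.act_act (β := β)
  have t2 := ratRefl_ratRefl K (n := n)
  simp only [LinearMap.sub_apply, Pi.sub_apply, Module.End.mul_apply]
  by_cases h1 : j.1 (prev b) = j.1 b
  · by_cases h2 : j.1 b = j.1 c
    · simp only [e, e', h1, h2, map_div₀, map_sub, map_neg, c1, c2, c3, c4, c5, c6, t2, s1, Ne,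
        not_true, and_false, if_false]
      field_simp
      ring
    · have h2' : ¬ j.1 c = j.1 b := fun h => h2 h.symm
      simp only [e, e', d, d', a0, a1, a2, b0, b1, b2, h1, h2, h2', map_div₀, map_sub, map_mul,
        map_neg, map_arrowFactor, c1, c2, c3, c4, c5, c6, t1, t2, s1, Ne,
        not_false_eq_true, not_true, false_and, if_false]
      field_simp
      ring
  · have h1' : ¬ j.1 b = j.1 (prev b) := fun h => h1 h.symm
    by_cases h2 : j.1 b = j.1 c
    · simp only [h2] at h1 h1'
      simp only [e, e', d, d', a0, a1, a2, b0, b1, b2, h1, h1', h2, map_div₀, map_sub, map_mul,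
        map_neg, map_arrowFactor, c1, c2, c3, c4, c5, c6, t1, t2, s1, Ne,
        not_false_eq_true, not_true, false_and, if_false]
      field_simp
      ring
    · have h2' : ¬ j.1 c = j.1 b := fun h => h2 h.symm
      by_cases h3 : j.1 (prev b) = j.1 c
      · simp only [h3] at h1 h1'
        simp only [e, e', d, d', a0, a1, a2, b0, b1, b2, h1, h1', h2, h2', h3, map_div₀, map_sub,
          map_mul, map_neg, map_arrowFactor, c1, c2, c3, c4, c5, c6, t1, t2, s1, Ne,
          not_false_eq_true, not_true, and_self, if_true]
        field_simp
        ring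
      · have h3' : ¬ j.1 c = j.1 (prev b) := fun h => h3 h.symm
        simp only [d, d', a0, a1, a2, b0, b1, b2, h1, h1', h2, h2', h3, h3', hact,
          map_mul, map_neg, map_arrowFactor, c1, c2, c3, c4, c5, c6, s1, Ne,
          not_false_eq_true, false_and, if_false]
        ring

end Braid

/-! ### The representation of the algebra. -/

section PolynomialRepresentation

variable {K : Type*} [Field K] {n l : ℕ} {q : Kˣ} {lam : Fin l → Kˣ} {β : StableFinset q lam n}

theorem arrowFactor_of_eq {L : Type*} [Field L] {u v : Kˣ} (h : u = q ^ (-2 : ℤ) * v) (x : L) :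
    arrowFactor q u v x = x := if_pos h

theorem arrowFactor_of_ne {L : Type*} [Field L] {u v : Kˣ} (h : u ≠ q ^ (-2 : ℤ) * v) (x : L) :
    arrowFactor q u v x = 1 := if_neg h

theorem eq_zpow_neg_two_mul_iff {u v : Kˣ} : u = q ^ (-2 : ℤ) * v ↔ v = q ^ (2 : ℤ) * u := by
  rw [zpow_neg, eq_inv_mul_iff_mul_eq, eq_comm]

/-- Reduces a relation multiplied by e(i) to an equality of diagonal coefficients in the component
`i` alone. -/
theorem mul_eOp_eq {X Y : Module.End K (β.Idx → RatFuncs K n)} {Z : β.Idx → RatFuncs K n}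
    (i : β.Idx) (hX : ∀ f j, X f j = Z j * f j) (hY : ∀ f j, Y f j = Z i * f j) :
    X * eOp β i = Y * eOp β i := by
  rw [mul_eOp_of_diagonal X Z i hX, mul_eOp_of_diagonal Y (fun _ => Z i) i hY]

/-- The operator by which a generator acts. -/
noncomputable def genOp (β : StableFinset q lam n) : Gen β → Module.End K (β.Idx → RatFuncs K n)
  | .psi a => psiOp β a
  | .y j => mulOp β (coord K j)
  | .e i => eOp β i

/-- The quiver has no loops. Hence the case of equal neighbours, where ψ_b² vanishes, never overlaps
with an arrow. -/
theorem zpow_two_mul_ne {u : Kˣ} (hq : q ^ 2 ≠ 1) : u ≠ q ^ (2 : ℤ) * u := by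
  intro h
  rw [right_eq_mul] at h
  exact hq (by exact_mod_cast h)

theorem zpow_neg_two_mul_ne {u : Kˣ} (hq : q ^ 2 ≠ 1) : u ≠ q ^ (-2 : ℤ) * u := fun h =>
  zpow_two_mul_ne hq (eq_zpow_neg_two_mul_iff.1 h)

open Classical in
theorem psiOp_sq_diagonal {b : Fin n} (hb : b.val ≠ 0) (f : β.Idx → RatFuncs K n) (j : β.Idx) :
    (psiOp β b ^ 2) f j =
      (if j.1 (prev b) = j.1 b then 0 else
        arrowFactor q (j.1 (prev b)) (j.1 b) (rootFn K b) *
          arrowFactor q (j.1 b) (j.1 (prev b)) (-rootFn K b)) * f j := by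
  split_ifs with h
  · rw [psiOp_sq_of_eq hb f h, zero_mul]
  · exact psiOp_sq_of_ne hb f h

theorem lift_genOp_rel (hq : q ^ 2 ≠ 1) {x z : FreeAlgebra K (Gen β)} (h : Rel β x z) :
    FreeAlgebra.lift K (genOp β) x = FreeAlgebra.lift K (genOp β) z := by
  classical
  induction h <;>
    simp only [map_sum, map_mul, map_sub, map_add, map_pow, map_neg, map_one, map_zero, map_ofNat,
      FreeAlgebra.lift_ι_apply, genOp]
  case e_sum =>
    refine LinearMap.ext fun f => funext fun j => ?_
    simp [LinearMap.sum_apply, eOp_apply]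
  case e_idem i =>
    refine LinearMap.ext fun f => funext fun j => ?_
    simp [eOp_apply]
  case e_orth i j h =>
    refine LinearMap.ext fun f => funext fun k => ?_
    simp [eOp_apply, h]
  case y_comm j k =>
    refine LinearMap.ext fun f => funext fun i => ?_
    simp only [Module.End.mul_apply, mulOp_apply]
    ring
  case y_e j i =>
    refine LinearMap.ext fun f => funext fun k => ?_
    simp [eOp_apply]
  case psi_e a i => exact psiOp_mul_eOp a i
  case psi_y_left b hb i h =>
    rw [← neg_one_mul (eOp β i)]
    have := psiOp_mul_coord (β := β) hb (prev b)
    rw [Equiv.swap_apply_left] at this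
    exact mul_eOp_eq i this fun f j => by simp [h]
  case psi_y_right b hb i h =>
    conv_rhs => rw [← one_mul (eOp β i)]
    have := psiOp_mul_coord (β := β) hb b
    rw [Equiv.swap_apply_right] at this
    exact mul_eOp_eq i this fun f j => by simp [h, (prev_ne hb).symm]
  case psi_y_else b hb j i h =>
    rw [← zero_mul (eOp β i)]
    refine mul_eOp_eq i (psiOp_mul_coord (β := β) hb j) fun f k => ?_
    by_cases h1 : i.1 (prev b) = i.1 b
    · have h2 : j ≠ prev b := fun h2 => h ⟨Or.inl h2, h1⟩
      have h3 : j ≠ b := fun h3 => h ⟨Or.inr h3, h1⟩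
      simp [h2, h3]
    · simp [h1]
  case psi_comm a b hb h =>
    rcases h with h | h
    · exact psiOp_comm h
    · exact (psiOp_comm h).symm
  case psi_sq_eq b hb i h =>
    rw [← zero_mul (eOp β i)]
    exact mul_eOp_eq i (psiOp_sq_diagonal hb) fun f j => by simp [h]
  case psi_sq_none b hb i h =>
    conv_rhs => rw [← one_mul (eOp β i)]
    refine mul_eOp_eq i (psiOp_sq_diagonal hb) fun f j => ?_
    rw [if_neg h.1, arrowFactor_of_ne (eq_zpow_neg_two_mul_iff.not.2 h.2.1),
      arrowFactor_of_ne h.2.2]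
    simp
  case psi_sq_to b hb i h =>
    refine mul_eOp_eq i (psiOp_sq_diagonal hb) fun f j => ?_
    rw [if_neg (by rw [h.1]; exact zpow_two_mul_ne hq),
      arrowFactor_of_eq (eq_zpow_neg_two_mul_iff.2 h.1), arrowFactor_of_ne h.2]
    simp [rootFn, sub_mul]
  case psi_sq_from b hb i h =>
    refine mul_eOp_eq i (psiOp_sq_diagonal hb) fun f j => ?_
    rw [if_neg (by rw [h.1]; exact zpow_neg_two_mul_ne hq),
      arrowFactor_of_ne (eq_zpow_neg_two_mul_iff.not.2 h.2), arrowFactor_of_eq h.1]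
    simp [rootFn, sub_mul]
  case psi_sq_both b hb i h =>
    refine mul_eOp_eq i (psiOp_sq_diagonal hb) fun f j => ?_
    rw [if_neg (by rw [h.1]; exact zpow_two_mul_ne hq),
      arrowFactor_of_eq (eq_zpow_neg_two_mul_iff.2 h.1), arrowFactor_of_eq h.2]
    simp [rootFn]
    ring
  case braid_to b c hb hc i h h' =>
    conv_rhs => rw [← one_mul (eOp β i)]
    refine mul_eOp_eq i (psiOp_braid hb hc) fun f j => ?_
    rw [if_pos ⟨h, by rw [h'.1]; exact zpow_two_mul_ne hq⟩,
      arrowFactor_of_eq (eq_zpow_neg_two_mul_iff.2 h'.1),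
      arrowFactor_of_ne h'.2, arrowFactor_of_ne h'.2,
      arrowFactor_of_eq (eq_zpow_neg_two_mul_iff.2 h'.1), mul_one, one_mul, sub_neg_eq_add,
      div_self (rootFn_add_ne_zero hc)]
    simp
  case braid_from b c hb hc i h h' =>
    rw [← neg_one_mul (eOp β i)]
    refine mul_eOp_eq i (psiOp_braid hb hc) fun f j => ?_
    rw [if_pos ⟨h, by rw [h'.1]; exact zpow_neg_two_mul_ne hq⟩,
      arrowFactor_of_ne (eq_zpow_neg_two_mul_iff.not.2 h'.2), arrowFactor_of_eq h'.1,
      arrowFactor_of_eq h'.1, arrowFactor_of_ne (eq_zpow_neg_two_mul_iff.not.2 h'.2),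
      mul_one, one_mul, ← neg_add', neg_div, div_self (rootFn_add_ne_zero hc)]
    simp
  case braid_both b c hb hc i h h' =>
    refine mul_eOp_eq i (psiOp_braid hb hc) fun f j => ?_
    rw [if_pos ⟨h, by rw [h'.1]; exact zpow_two_mul_ne hq⟩,
      arrowFactor_of_eq (eq_zpow_neg_two_mul_iff.2 h'.1), arrowFactor_of_eq h'.2,
      arrowFactor_of_eq h'.2, arrowFactor_of_eq (eq_zpow_neg_two_mul_iff.2 h'.1)]
    have hne := rootFn_add_ne_zero (K := K) hc
    have hp : prev c = b := by simp only [Fin.ext_iff, prev]; omega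
    -- The numerator is E² - D² = (E - D)(E + D), and E - D = y_{b+2} - 2y_{b+1} + y_b.
    rw [two_mul]
    simp only [LinearMap.sub_apply, LinearMap.add_apply, Pi.sub_apply, Pi.add_apply,
      mulOp_apply]
    field_simp
    simp only [rootFn, hp]
    ring
  case braid_else b c hb hc i h =>
    rw [← zero_mul (eOp β i)]
    refine mul_eOp_eq i (psiOp_braid hb hc) fun f j => ?_
    split_ifs with h1
    · have h2 : i.1 b ≠ q ^ (2 : ℤ) * i.1 c := fun h2 => by
        by_cases h3 : i.1 b = q ^ (-2 : ℤ) * i.1 c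
        · exact h ⟨h1.1, Or.inr (Or.inr ⟨h2, h3⟩)⟩
        · exact h ⟨h1.1, Or.inl ⟨h2, h3⟩⟩
      have h3 : i.1 b ≠ q ^ (-2 : ℤ) * i.1 c := fun h3 =>
        h ⟨h1.1, Or.inr (Or.inl ⟨h3, h2⟩)⟩
      rw [arrowFactor_of_ne (eq_zpow_neg_two_mul_iff.not.2 h2), arrowFactor_of_ne h3,
        arrowFactor_of_ne h3, arrowFactor_of_ne (eq_zpow_neg_two_mul_iff.not.2 h2)]
      simp
    · simp
  case psi_zero_y_one a ha =>
    refine LinearMap.ext fun f => funext fun j => ?_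
    simp [psiOp_zero ha, ratRefl_coord, ha]
  case psi_zero_y a j ha hj =>
    have hja : j ≠ a := by rintro rfl; exact hj ha
    refine LinearMap.ext fun f => funext fun j => ?_
    simp [psiOp_zero ha, ratRefl_coord, ha, hja]
  case psi_zero_sq a ha =>
    refine LinearMap.ext fun f => funext fun j => ?_
    simp [sq, psiOp_zero ha, ratRefl_ratRefl, StableFinset.act_act]
  case psi_zero_one a b ha hb =>
    have := psiOp_zero_one (β := β) ha hb
    rw [sq, sq, sub_eq_zero, ← mul_assoc, this, ← mul_assoc]

/-- The representation of `V_𝛌^β` on tuples of rational functions. -/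
noncomputable def ratRep (β : StableFinset q lam n) (hq : q ^ 2 ≠ 1) :
    V β →ₐ[K] Module.End K (β.Idx → RatFuncs K n) :=
  RingQuot.liftAlgHom K ⟨FreeAlgebra.lift K (genOp β), fun _ _ h => lift_genOp_rel hq h⟩

theorem ratRep_gen (hq : q ^ 2 ≠ 1) (g : Gen β) : ratRep β hq (V.gen β g) = genOp β g := by
  simp [ratRep, V.gen]

theorem ratRep_yMonomial (hq : q ^ 2 ≠ 1) (m : Fin n → ℕ) (f : β.Idx → RatFuncs K n)
    (j : β.Idx) :
    ratRep β hq (V.yMonomial β m) f j = (∏ k, coord K k ^ m k) * f j := by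
  have hy : ∀ (k : Fin n) (r : ℕ) (f : β.Idx → RatFuncs K n) (j : β.Idx),
      ratRep β hq (V.y β k ^ r) f j = coord K k ^ r * f j := by
    intro k r f j
    rw [map_pow, V.y, ratRep_gen]
    induction r generalizing f with
    | zero => simp
    | succ r ih => rw [pow_succ, Module.End.mul_apply, ih, genOp, mulOp_apply]; ring
  have key : ∀ (L : List (Fin n)) (f : β.Idx → RatFuncs K n),
      ratRep β hq (L.map fun k => V.y β k ^ m k).prod f j =
        (L.map fun k => coord K k ^ m k).prod * f j := by
    intro L
    induction L with
    | nil => simp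
    | cons k L ih =>
      intro f
      rw [List.map_cons, List.prod_cons, map_mul, Module.End.mul_apply, hy, ih, List.map_cons,
        List.prod_cons, mul_assoc]
  rw [V.yMonomial, List.ofFn_eq_map, key, ← List.ofFn_eq_map, List.prod_ofFn]

end PolynomialRepresentation

/-! ### Linear independence: leading terms and Dedekind's lemma. -/

section Independence

variable {K : Type*} [Field K] {n l : ℕ} {q : Kˣ} {lam : Fin l → Kˣ} {β : StableFinset q lam n}

theorem wordProd_single_apply (ω : List (Fin n)) (j k : Fin n) :
    wordProd ω (Pi.single j 1) k = 0 ∨ wordProd ω (Pi.single j 1) k = 1 ∨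
      wordProd ω (Pi.single j 1) k = -1 := by
  induction ω generalizing k with
  | nil =>
    simp only [wordProd_nil, LinearEquiv.coe_one, id, Pi.single_apply]
    split_ifs <;> simp
  | cons a ω ih =>
    rw [wordProd_cons, LinearEquiv.mul_apply, simpleReflection_apply]
    split_ifs
    · have := ih k; omega
    · exact ih k
    · exact ih _

/-- Matrix entries of Weyl group elements are 0, 1 or -1, and these stay distinct in `K`. In
characteristic 2 sign changes would act trivially on the variables. -/
theorem intCast_inj_of_ringChar_ne_two (hK : ringChar K ≠ 2) {c d : ℤ}
    (hc : c = 0 ∨ c = 1 ∨ c = -1) (hd : d = 0 ∨ d = 1 ∨ d = -1) (h : (c : K) = d) : c = d := by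
  have h2 : (2 : K) ≠ 0 := Ring.two_ne_zero hK
  rcases hc with rfl | rfl | rfl <;> rcases hd with rfl | rfl | rfl <;> simp at h ⊢
  · exact h2 (by linear_combination h)
  · exact h2 (by linear_combination -h)

theorem ratAct_injective_of_wordProd (hK : ringChar K ≠ 2) {ω ω' : List (Fin n)}
    (h : ratAct K (wordProd ω) = ratAct K (wordProd ω')) : wordProd ω = wordProd ω' := by
  refine LinearEquiv.toLinearMap_injective (LinearMap.pi_ext' fun j => LinearMap.ext_ring ?_)
  funext k
  refine intCast_inj_of_ringChar_ne_two hK (wordProd_single_apply ω j k)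
    (wordProd_single_apply ω' j k) ?_
  have hj := DFunLike.congr_fun h (coord K j)
  rw [ratAct_coord, ratAct_coord] at hj
  have hj' : ∑ m, wordProd ω (Pi.single j 1) m • (MvPolynomial.X m : MvPolynomial (Fin n) K) =
      ∑ m, wordProd ω' (Pi.single j 1) m • MvPolynomial.X m := by
    apply IsFractionRing.injective (MvPolynomial (Fin n) K) (RatFuncs K n)
    simpa only [map_sum, map_zsmul, coord] using hj
  have hcoeff : ∀ x : Lattice n, MvPolynomial.coeff (Finsupp.single k 1)
      (∑ m, x m • (MvPolynomial.X m : MvPolynomial (Fin n) K)) = x k := fun x => by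
    have hm : ∀ m, x m • (MvPolynomial.X m : MvPolynomial (Fin n) K) =
        MvPolynomial.C (x m : K) * MvPolynomial.X m := fun m => by
      rw [zsmul_eq_mul, map_intCast]
    simp only [hm, MvPolynomial.coeff_sum, MvPolynomial.coeff_C_mul]
    rw [Finset.sum_eq_single k]
    · simp
    · intro m _ hmk
      rw [MvPolynomial.coeff_X, if_neg, mul_zero]
      rw [Finsupp.single_left_inj one_ne_zero]
      exact hmk
    · simp
  exact (hcoeff _).symm.trans ((congrArg _ hj').trans (hcoeff _))

/-- A common shape for all cases, with an invertible coefficient at the reflection: a divided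
difference has coefficients -1/(y_{b+1} - y_b) and 1/(y_{b+1} - y_b), since r_a then fixes the
component. -/
theorem exists_psiOp_eq (a : Fin n) :
    ∃ A B : β.Idx → RatFuncs K n, (∀ j, A j ≠ 0) ∧ ∀ f j,
      psiOp β a f j = A j * ratRefl K a (f (β.act a j)) + B j * f j := by
  classical
  by_cases ha : a.val = 0
  · exact ⟨1, 0, fun _ => one_ne_zero, fun f j => by simp [psiOp_zero ha]⟩
  have hne := rootFn_ne_zero K ha
  refine ⟨fun j => if j.1 (prev a) = j.1 a then -(rootFn K a)⁻¹ else
      arrowFactor q (j.1 (prev a)) (j.1 a) (rootFn K a),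
    fun j => if j.1 (prev a) = j.1 a then (rootFn K a)⁻¹ else 0, fun j => ?_, fun f j => ?_⟩
  · dsimp only
    split_ifs
    · exact neg_ne_zero.2 (inv_ne_zero hne)
    · exact arrowFactor_ne_zero _ _ hne
  · dsimp only
    split_ifs with h
    · rw [psiOp_eq ha f h, StableFinset.act_eq_self ha h]
      ring
    · rw [psiOp_ne ha f h]
      ring

open Classical in
/-- The operator of `ψ_ω` is a combination of the automorphisms given by the product of `ω` and
by products of shorter words; if `ω` is reduced, the former occurs. -/
theorem exists_expansion (hq : q ^ 2 ≠ 1) (i : β.Idx) (ω : List (Fin n)) :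
    ∃ c : weylGroupB n →₀ (β.Idx → RatFuncs K n),
      (∀ F j, ratRep β hq (V.psiWord β ω) (Pi.single i F) j =
        c.sum fun g v => v j * ratAct K (g : Lattice n ≃ₗ[ℤ] Lattice n) F) ∧
      (∀ g : weylGroupB n, c g ≠ 0 →
        wordProd ω = g ∨ ∃ u : List (Fin n), u.length < ω.length ∧ wordProd u = g) ∧
      (IsReduced ω → ∃ j, c ⟨wordProd ω, wordProd_mem ω⟩ j ≠ 0) := by
  induction ω with
  | nil =>
    refine ⟨Finsupp.single 1 (Pi.single i 1), fun F j => ?_, fun g hg => Or.inl ?_,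
      fun _ => ⟨i, ?_⟩⟩
    · rw [Finsupp.sum_single_index (by simp)]
      simp only [V.psiWord, List.map_nil, List.prod_nil, map_one, Module.End.one_apply,
        Pi.single_apply, OneMemClass.coe_one, AlgEquiv.one_apply]
      split_ifs <;> simp
    · by_contra h
      refine hg (Finsupp.single_eq_of_ne fun h' => h ?_)
      rw [h']; rfl
    · have : (⟨wordProd [], wordProd_mem []⟩ : weylGroupB n) = 1 := rfl
      rw [this, Finsupp.single_eq_same]
      simp
  | cons a ω ih =>
    obtain ⟨c, h1, h2, h3⟩ := ih
    obtain ⟨A, B, hA, hAB⟩ := exists_psiOp_eq (β := β) a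
    let r : weylGroupB n := ⟨simpleReflection a, simpleReflection_mem a⟩
    have hr : r⁻¹ = r := Subtype.ext (simpleReflection_inv a)
    let T : (β.Idx → RatFuncs K n) → β.Idx → RatFuncs K n := fun v j =>
      A j * ratRefl K a (v (β.act a j))
    let U : (β.Idx → RatFuncs K n) → β.Idx → RatFuncs K n := fun v j => B j * v j
    have hT : T 0 = 0 := by funext j; simp [T]
    have hU : U 0 = 0 := by funext j; simp [U]
    -- Applying ψ_a moves the term of r g to g through `T` and keeps the term of g through `U`; here
    -- r⁻¹ = r.
    have happ : ∀ g, ((c.mapRange T hT).equivMapDomain (Equiv.mulLeft r) + c.mapRange U hU) g =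
        T (c (r * g)) + U (c g) := fun g => by
      simp [Finsupp.equivMapDomain_apply, hr]
    refine ⟨(c.mapRange T hT).equivMapDomain (Equiv.mulLeft r) + c.mapRange U hU,
      fun F j => ?_, fun g hg => ?_, fun hred => ?_⟩
    · rw [V.psiWord_cons, map_mul, Module.End.mul_apply, V.psi, ratRep_gen, genOp, hAB, h1, h1,
        Finsupp.sum_add_index' (by simp) (by intros; simp [add_mul]),
        Finsupp.equivMapDomain_eq_mapDomain,
        Finsupp.sum_mapDomain_index (by simp) (by intros; simp [add_mul]),
        Finsupp.sum_mapRange_index (by simp), Finsupp.sum_mapRange_index (by simp)]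
      simp only [Finsupp.sum, map_sum, Finset.mul_sum, map_mul]
      congr 1
      · refine Finset.sum_congr rfl fun g _ => ?_
        simp only [T, r, ratRefl, Equiv.coe_mulLeft, Subgroup.coe_mul, map_mul,
          AlgEquiv.mul_apply, mul_assoc]
      · refine Finset.sum_congr rfl fun g _ => ?_
        simp only [U, mul_assoc]
    · rw [happ] at hg
      by_cases hg' : c g = 0
      · rw [hg', hU, add_zero] at hg
        have hrg : c (r * g) ≠ 0 := fun h => hg (by rw [h, hT])
        have hgr : simpleReflection a * ((r * g : weylGroupB n) : Lattice n ≃ₗ[ℤ] Lattice n) = g :=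
          simpleReflection_mul_cancel_left a _
        rcases h2 _ hrg with h | ⟨u, hu, hu'⟩
        · left; rw [wordProd_cons, h, hgr]
        · right; exact ⟨a :: u, by simpa using hu, by rw [wordProd_cons, hu', hgr]⟩
      · right
        rcases h2 _ hg' with h | ⟨u, hu, hu'⟩
        · exact ⟨ω, by simp, h⟩
        · exact ⟨u, by simp; omega, hu'⟩
    · obtain ⟨j, hj⟩ := h3 hred.tail
      refine ⟨β.act a j, ?_⟩
      -- The part kept by `U` cannot reach the leading element, which would otherwise be the product
      -- of a word no longer than `ω`, against reducedness. So the leading coefficient comes from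
      -- `T` alone and is nonzero, now in component r_a j.
      have hc : c ⟨wordProd (a :: ω), wordProd_mem _⟩ = 0 := by
        by_contra hc
        rcases h2 _ hc with h | ⟨u, hu, hu'⟩
        · have := hred _ h
          simp at this
        · have := hred _ hu'
          simp at this
          omega
      have hrw : r * ⟨wordProd (a :: ω), wordProd_mem _⟩ = ⟨wordProd ω, wordProd_mem ω⟩ :=
        Subtype.ext (by simp [r, wordProd_cons, simpleReflection_mul_cancel_left])
      rw [happ, hc, hU, add_zero, hrw]
      simp only [T, StableFinset.act_act]
      exact mul_ne_zero (hA _) ((map_ne_zero _).2 hj)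

theorem linearIndependent_coord_prod :
    LinearIndependent K fun m : Fin n → ℕ => ∏ k, coord K k ^ m k := by
  have h := (MvPolynomial.basisMonomials (Fin n) K).linearIndependent
  have h' := (h.map' (IsScalarTower.toAlgHom K (MvPolynomial (Fin n) K)
    (RatFuncs K n)).toLinearMap (LinearMap.ker_eq_bot.2
      (IsFractionRing.injective (MvPolynomial (Fin n) K) (RatFuncs K n)))).comp
    (Finsupp.equivFunOnFinite (α := Fin n) (M := ℕ)).symm (Equiv.injective _)
  have hf : (fun m : Fin n → ℕ => ∏ k, coord K k ^ m k) = fun m =>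
      algebraMap (MvPolynomial (Fin n) K) (RatFuncs K n)
        (MvPolynomial.basisMonomials (Fin n) K (Finsupp.equivFunOnFinite.symm m)) := by
    funext m
    simp only [MvPolynomial.coe_basisMonomials, coord]
    rw [MvPolynomial.monomial_eq, map_one, one_mul, Finsupp.prod_fintype _ _ (by simp)]
    simp
  rw [hf]
  exact h'

theorem linearIndependent_ratAct (hK : ringChar K ≠ 2) {red : weylGroupB n → List (Fin n)}
    (hred : ∀ w, IsReducedExpression (red w) w) :
    LinearIndependent (RatFuncs K n) fun (w : weylGroupB n) (F : RatFuncs K n) =>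
      ratAct K (w : Lattice n ≃ₗ[ℤ] Lattice n) F := by
  let φ : weylGroupB n → (RatFuncs K n →* RatFuncs K n) := fun w =>
    ((ratAct K (w : Lattice n ≃ₗ[ℤ] Lattice n)).toMulEquiv : RatFuncs K n →* RatFuncs K n)
  have hφ : Function.Injective φ := fun w w' h => by
    have h' : ratAct K (w : Lattice n ≃ₗ[ℤ] Lattice n) = ratAct K w' := by
      ext x
      exact congrArg (fun f : RatFuncs K n →* RatFuncs K n => f x) h
    -- Faithfulness was shown for products of simple reflections; the reduced expressions present
    -- every element of the group as one.
    have e : ∀ w : weylGroupB n, wordProd (red w) = w := fun w => (hred w).1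
    rw [← e w, ← e w'] at h'
    exact Subtype.ext ((e w).symm.trans ((ratAct_injective_of_wordProd hK h').trans (e w')))
  exact (linearIndependent_monoidHom (RatFuncs K n) (RatFuncs K n)).comp φ hφ

/-- In a relation choose a term (w, m₀, i) with `w` of greatest length, apply the relation to
functions supported in component `i`, and read off the coefficient of the automorphism `w` in a
component `j` where the leading coefficient of ψ_w is nonzero. -/
theorem linearIndependent_basis (hK : ringChar K ≠ 2) (hq : q ^ 2 ≠ 1)
    {red : weylGroupB n → List (Fin n)} (hred : ∀ w, IsReducedExpression (red w) w) :
    LinearIndependent K fun t : weylGroupB n × (Fin n → ℕ) × β.Idx =>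
      V.yMonomial β t.2.1 * V.psiWord β (red t.1) * V.e β t.2.2 := by
  classical
  rw [linearIndependent_iff]
  intro p hp
  by_contra hp0
  obtain ⟨⟨w, m₀, i⟩, ht, hmax⟩ := Finset.exists_max_image p.support
    (fun t => (red t.1).length) (Finsupp.support_nonempty_iff.2 hp0)
  choose c hc1 hc2 hc3 using fun w => exists_expansion (β := β) hq i (red w)
  have hrw : ∀ w : weylGroupB n, wordProd (red w) = w := fun w => (hred w).1
  obtain ⟨j, hj⟩ := hc3 w (isReduced_of_isReducedExpression (hred w))
  have hww : (⟨wordProd (red w), wordProd_mem _⟩ : weylGroupB n) = w := Subtype.ext (hrw w)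
  rw [hww] at hj
  have hev : ∀ v : β.Idx → RatFuncs K n, v = 0 → v j = 0 := fun v hv => by rw [hv]; rfl
  -- The whole relation, evaluated from component `i` to component `j`, as a combination of Weyl
  -- group automorphisms; Dedekind's lemma makes every coefficient vanish.
  let total : weylGroupB n →₀ RatFuncs K n := ∑ t ∈ p.support,
    if t.2.2 = i then
      (p t • ∏ k, coord K k ^ t.2.1 k) • (c t.1).mapRange (fun v => v j) rfl
    else 0
  have htotal : total = 0 := by
    refine linearIndependent_iff.1 (linearIndependent_ratAct hK hred) total ?_
    funext F
    have h0 := congrFun (DFunLike.congr_fun (congrArg (ratRep β hq) hp) (Pi.single i F)) j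
    rw [Finsupp.linearCombination_apply, Finsupp.sum, map_sum, LinearMap.sum_apply,
      Finset.sum_apply, map_zero] at h0
    refine Eq.trans ?_ h0
    rw [map_sum, Finset.sum_apply]
    refine Finset.sum_congr rfl fun t _ => ?_
    rw [map_smul, map_mul, map_mul, LinearMap.smul_apply, Pi.smul_apply, Module.End.mul_apply,
      Module.End.mul_apply, ratRep_yMonomial, V.e, ratRep_gen, genOp]
    by_cases hti : t.2.2 = i
    · have he : eOp β t.2.2 (Pi.single i F) = Pi.single i F := by
        funext k
        rw [eOp_apply, hti, Pi.single_eq_same, Pi.single_apply]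
      rw [if_pos hti, he, hc1, map_smul, Finsupp.linearCombination_apply,
        Finsupp.sum_mapRange_index (by simp), Pi.smul_apply, Finsupp.sum, Finset.sum_apply,
        smul_eq_mul, smul_mul_assoc]
      rfl
    · have he : eOp β t.2.2 (Pi.single i F) = 0 := by
        funext k
        rw [eOp_apply, Pi.single_eq_of_ne hti]
        simp
      rw [if_neg hti, he, map_zero, map_zero]
      simp
  have hw := DFunLike.congr_fun htotal w
  rw [Finsupp.finsetSum_apply] at hw
  let p' : (Fin n → ℕ) →₀ K := p.comapDomain (fun m => (w, m, i)) fun m _ m' _ h => by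
    simpa using h
  have hmem : ∀ m, m ∈ p'.support ↔ (w, m, i) ∈ p.support := fun m => by
    rw [Finsupp.mem_support_iff, Finsupp.mem_support_iff]
    rfl
  have hp' : p' = 0 := by
    refine linearIndependent_iff.1 (linearIndependent_coord_prod (K := K) (n := n)) p' ?_
    refine (mul_eq_zero.1 ?_).resolve_right hj
    rw [Finsupp.linearCombination_apply, Finsupp.sum, Finset.sum_mul]
    refine Eq.trans ?_ hw
    refine Finset.sum_bij_ne_zero (fun m _ _ => (w, m, i)) (fun m hm _ => (hmem m).1 hm)
      (fun m _ _ m' _ _ h => by simpa using h) (fun t ht' h0 => ?_) (fun m hm _ => ?_)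
    · by_cases hti : t.2.2 = i
      · rw [if_pos hti, Finsupp.smul_apply, Finsupp.mapRange_apply] at h0
        have hcw : c t.1 w ≠ 0 := fun h => h0 (by rw [h]; exact smul_zero _)
        -- If ψ of another element `t.1` involved `w`, then `w` would have a word shorter than the
        -- reduced word of `t.1`, which is no longer than that of `w`.
        have htw : t.1 = w := by
          rcases hc2 _ _ hcw with h | ⟨u, hu, hu'⟩
          · exact Subtype.ext ((hrw _).symm.trans h)
          · have h1 := hmax t ht'
            have h2 := (hred w).2 u hu'
            simp only at h1
            omega
        obtain ⟨w', m, i'⟩ := t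
        obtain rfl : w' = w := htw
        obtain rfl : i' = i := hti
        refine ⟨m, (hmem m).2 ht', ?_, rfl⟩
        exact mul_ne_zero (left_ne_zero_of_smul h0) hj
      · exact absurd (by rw [if_neg hti]; rfl) h0
    · rw [if_pos rfl]
      rfl
  have := DFunLike.congr_fun hp' m₀
  exact Finsupp.mem_support_iff.1 ht this

end Independence
end QuiverHeckeB

/-! ### The basis theorem. -/

theorem mainTheorem1 {K : Type*} [Field K] (hK : ringChar K ≠ 2)
    (q : Kˣ) (hq : q ^ 2 ≠ 1)
    {l : ℕ} (lam : Fin l → Kˣ)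
    (hlam : ∀ a b, a ≠ b →
      QuiverHeckeB.vertexClass q (lam a) ∩ QuiverHeckeB.vertexClass q (lam b) = ∅)
    (n : ℕ) (hn : 1 ≤ n) (β : QuiverHeckeB.StableFinset q lam n)
    (red : QuiverHeckeB.weylGroupB n → List (Fin n))
    (hred : ∀ w, QuiverHeckeB.IsReducedExpression (red w) w) :
    ∃ B : Module.Basis (QuiverHeckeB.weylGroupB n × (Fin n → ℕ) × β.Idx) K (QuiverHeckeB.V β),
      ∀ (w : QuiverHeckeB.weylGroupB n) (m : Fin n → ℕ) (i : β.Idx),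
        B (w, m, i) = QuiverHeckeB.V.yMonomial β m * QuiverHeckeB.V.psiWord β (red w) *
          QuiverHeckeB.V.e β i :=
  ⟨Module.Basis.mk (QuiverHeckeB.linearIndependent_basis hK hq hred)
    (QuiverHeckeB.V.span_eq_top hred), fun w m i => by rw [Module.Basis.mk_apply]⟩
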